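/- Graphs are finite and may have loops and multiple edges. For a set $A$ of vertices of a graph $G$, the edge cut of $A$ is the set of edges with exactly one end in $A$. For an integer $\lambda$, the graph $G$ is $\lambda$-edge-connected if the edge cut of every nonempty proper subset $A\subsetneq V(G)$ has at least $\lambda$ edges, and $G$ is essentially $\lambda$-edge-connected if, for every such $A$ whose edge cut has strictly fewer than $\lambda$ edges, all edges of that edge cut are incident with a common vertex. A factor of $G$ is a spanning subgraph of $G$, and a graph is modulo $k$-regular if the degree of each of its vertices is positive and divisible by $k$. Theorem. Let $k$ be a positive integer and let $G$ be a graph with at least two vertices. (1) If $G$ is $(4k-1)$-edge-connected and essentially $(6k-7)$-edge-connected, then $G$ has a bipartite modulo $k$-regular factor. (2) If $G$ is bipartite, $2k$-edge-connected and essentially $(3k-3)$-edge-connected, then $G$ has a (bipartite) modulo $k$-regular factor. -/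

import Mathlib

/-!
Multigraphs (loops and parallel edges allowed) are Mathlib's `Graph α β`. The cardinalities
below are meant for graphs with finitely many edges.
-/

namespace Graph

variable {α β : Type*}

/-- The degree of `v` in a multigraph with finitely many edges; a loop at `v` counts twice. -/
noncomputable def vertexDegree (G : Graph α β) (v : α) : ℕ :=
  (G.incidenceSet v).ncard + (G.loopSet v).ncard

/-- The edge cut of a vertex set `A`: the edges with exactly one end in `A`. -/
def edgeCut (G : Graph α β) (A : Set α) : Set β :=
  {e | ∃ x y, G.IsLink e x y ∧ x ∈ A ∧ y ∉ A}

/-- `G` is `l`-edge-connected: for every nonempty proper subset `A` of the vertex set there are at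
least `l` edges with exactly one end in `A`. -/
def IsEdgeConnected (G : Graph α β) (l : ℤ) : Prop :=
  ∀ A ⊆ G.vertexSet, A.Nonempty → A ≠ G.vertexSet → l ≤ ((G.edgeCut A).ncard : ℤ)

/-- `G` is essentially `l`-edge-connected: all edges of any edge cut of size strictly less than `l`
are incident with a common vertex. -/
def IsEssentiallyEdgeConnected (G : Graph α β) (l : ℤ) : Prop :=
  ∀ A ⊆ G.vertexSet, A.Nonempty → A ≠ G.vertexSet → ((G.edgeCut A).ncard : ℤ) < l →
    ∃ v ∈ G.vertexSet, ∀ e ∈ G.edgeCut A, G.Inc e v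

/-- `G` is bipartite: the vertex set splits into `X` and its complement so that every edge has one
end in each part (in particular there are no loops). -/
def IsBipartiteGraph (G : Graph α β) : Prop :=
  ∃ X ⊆ G.vertexSet, ∀ e x y, G.IsLink e x y → (x ∈ X ↔ y ∉ X)

/-- `G` is modulo `k`-regular: all its degrees are positive and divisible by `k`. -/
def IsModuloRegular (G : Graph α β) (k : ℕ) : Prop :=
  ∀ v ∈ G.vertexSet, 0 < G.vertexDegree v ∧ k ∣ G.vertexDegree v

/-- `G` has a factor (a spanning subgraph) that is bipartite and modulo `k`-regular. -/
def HasBipartiteModuloRegularFactor (G : Graph α β) (k : ℕ) : Prop :=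
  ∃ H : Graph α β, H.IsSpanningSubgraph G ∧ H.IsBipartiteGraph ∧ H.IsModuloRegular k

end Graph

/-! For bipartite `G` with part `X`, let `σ e = 1` direct `e` out of `X` and `σ e = -1` direct it
into `X`, and let the factor consist of the edges with `σ e = 1`. Up to a sign depending on the side
of `v`, the excess at `v` is twice the degree in the factor minus the degree in `G`. Prescribing it
modulo `2 * k` makes the factor degrees divisible by `k`, and an excess smaller than `2 * k`, which
is at most the degree in `G`, makes them positive.

Such orientations come from `Net.Valid.solvable`, which asks that every cut exceed some admissible
excess by `2 * k - 2`. Cuts with at least `3 * k - 3` edges do so because every residue class modulo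
`2 * k` has a member of size at most `k`; in a smaller cut all edges meet one vertex, hence all run
the same way between the two parts, and the prescription of the cut is congruent to its degree minus
`2 * k` up to sign. A general graph is first replaced by a maximum cut, which keeps half of every
edge cut (`exists_bipartite_restrict`).

The orientation theorem is proved by induction. A tight set with several vertices is contracted;
once the contracted net is oriented, the inside is solved with the cut edges as fixed outer arcs
(`Valid.solvable_of_tight`). If all larger sets are loose, they can lose two units, so pairs of
edges at a vertex that is loose or has zero prescription are lifted (`Valid.exists_reduction`). If
no such vertex is left, every vertex is tight with nonzero demand, and directing and deleting one
suitable edge or arc moves demands towards zero (`Valid.solvable_of_tight_vertices`). -/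

/-- A multigraph with vertex set `U` and edge set `E` (the ends of `e` are `s e` and `t e`), in which
`o v` arcs enter the vertex `v` from an outer vertex and `i v` arcs leave `v` towards it, together
with a prescription `b` of the excess of every vertex. -/
structure Net (V β : Type*) where
  U : Finset V
  E : Finset β
  s : β → V
  t : β → V
  o : V → ℤ
  i : V → ℤ
  b : V → ℤ

/-! ### Nets: degrees, excesses and the hypothesis of the orientation theorem. -/

namespace Net

open Finset

variable {V β : Type*} [DecidableEq V]

/-- The indicator of a finite set. -/
def ind (A : Finset V) (x : V) : ℤ := if x ∈ A then 1 else 0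

/-- The incidence number of an edge with a vertex set. -/
def inc (N : Net V β) (e : β) (A : Finset V) : ℤ := ind A (N.s e) - ind A (N.t e)

/-- The number of edges and outer arcs leaving a vertex set. -/
def deg (N : Net V β) (A : Finset V) : ℤ := ∑ e ∈ N.E, |N.inc e A| + ∑ v ∈ A, (N.o v + N.i v)

/-- The excess of out-going over in-coming edges at `A` when `e` is directed from `s e` to `t e` if
`σ e = 1` and backwards if `σ e = -1`. -/
def excess (N : Net V β) (σ : β → ℤ) (A : Finset V) : ℤ :=
  ∑ e ∈ N.E, σ e * N.inc e A + ∑ v ∈ A, (N.i v - N.o v)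

/-- A net is solvable if it has an orientation whose excesses are as prescribed modulo `2 * k` and
smaller than `2 * k`. -/
def Solvable (k : ℤ) (N : Net V β) : Prop :=
  ∃ σ : β → ℤ, (∀ e, σ e = 1 ∨ σ e = -1) ∧
    ∀ v ∈ N.U, 2 * k ∣ N.excess σ {v} - N.b v ∧ |N.excess σ {v}| < 2 * k

/-- The degree of `A` exceeds the size of the smallest admissible excess of `A` by `l` at least. -/
def Slack (k l : ℤ) (N : Net V β) (A : Finset V) : Prop :=
  ∃ m : ℤ, |∑ v ∈ A, N.b v + 2 * k * m| + l ≤ N.deg A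

/-- The hypothesis of the orientation theorem: the prescription `b` has the right parity and total, the
outer arcs are few, and every proper nonempty vertex set except `S` (empty or a single vertex, whose
prescription is zero modulo `2 * k`) has slack at least `2 * k - 2`. -/
structure Valid (k : ℤ) (N : Net V β) (S : Finset V) : Prop where
  ends : ∀ e ∈ N.E, N.s e ∈ N.U ∧ N.t e ∈ N.U
  o_nonneg : ∀ v, 0 ≤ N.o v
  i_nonneg : ∀ v, 0 ≤ N.i v
  parity : ∀ v ∈ N.U, (2 : ℤ) ∣ N.deg {v} - N.b v
  balanced : 2 * k ∣ ∑ v ∈ N.U, N.b v - ∑ v ∈ N.U, (N.i v - N.o v)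
  net_lt : |∑ v ∈ N.U, (N.i v - N.o v)| < 2 * k
  -- Tightness of the outside, seen as one more vertex whose edges are already directed: its degree
  -- exceeds no admissible excess by more than `2 * k - 2`. This is what a tight cut leaves behind
  -- when its inside is solved separately.
  upper : ∀ m : ℤ, ∑ v ∈ N.U, (N.o v + N.i v) ≤
    2 * k - 2 + |∑ v ∈ N.U, (N.i v - N.o v) + 2 * k * m|
  lower : ∀ A ⊆ N.U, A.Nonempty → A ≠ N.U → A ≠ S → N.Slack k (2 * k - 2) A
  exempt : ∀ x ∈ S, x ∈ N.U ∧ 2 * k ∣ N.b x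
  card_le : S.card ≤ 1

/-! ### Indicators and additivity -/

lemma ind_of_mem {A : Finset V} {x : V} (h : x ∈ A) : ind A x = 1 := if_pos h

lemma ind_of_notMem {A : Finset V} {x : V} (h : x ∉ A) : ind A x = 0 := if_neg h

lemma ind_cases (A : Finset V) (x : V) : (x ∈ A ∧ ind A x = 1) ∨ (x ∉ A ∧ ind A x = 0) := by
  by_cases h : x ∈ A <;> simp [ind, h]

lemma sum_ite_eq_ind (A : Finset V) (x : V) (c : ℤ) :
    (∑ v ∈ A, if v = x then c else 0) = c * ind A x := by
  simp [ind]

lemma sum_ind_singleton (A : Finset V) (x : V) : ∑ v ∈ A, ind {v} x = ind A x := by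
  simp [ind]

lemma sum_inc_singleton (N : Net V β) (e : β) (A : Finset V) :
    ∑ v ∈ A, N.inc e {v} = N.inc e A := by
  simp [inc, Finset.sum_sub_distrib, sum_ind_singleton]

lemma sum_excess_singleton (N : Net V β) (σ : β → ℤ) (A : Finset V) :
    ∑ v ∈ A, N.excess σ {v} = N.excess σ A := by
  simp only [excess, sum_singleton]
  rw [sum_add_distrib, sum_comm]
  simp [← mul_sum, sum_inc_singleton]

lemma abs_inc_cases (N : Net V β) (e : β) (A : Finset V) :
    N.inc e A = 0 ∨ N.inc e A = 1 ∨ N.inc e A = -1 := by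
  unfold inc
  rcases ind_cases A (N.s e) with h | h <;> rcases ind_cases A (N.t e) with h' | h' <;> omega

lemma two_dvd_abs_sub (a : ℤ) : (2 : ℤ) ∣ |a| - a := by
  rcases abs_cases a with h | h <;> omega

/-- Modulo 2 absolute values can be dropped, and without them the incidence numbers are additive
over vertices. -/
lemma two_dvd_deg_sub (N : Net V β) (A : Finset V) :
    (2 : ℤ) ∣ N.deg A - ∑ v ∈ A, N.deg {v} := by
  have h1 : ∀ B : Finset V,
      (2 : ℤ) ∣ N.deg B - (∑ e ∈ N.E, N.inc e B + ∑ v ∈ B, (N.o v + N.i v)) := by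
    intro B
    have : N.deg B - (∑ e ∈ N.E, N.inc e B + ∑ v ∈ B, (N.o v + N.i v))
        = ∑ e ∈ N.E, (|N.inc e B| - N.inc e B) := by
      rw [deg, sum_sub_distrib]; ring
    rw [this]
    exact dvd_sum fun e _ => two_dvd_abs_sub _
  have h2 : (2 : ℤ) ∣ ∑ v ∈ A, (N.deg {v} -
      (∑ e ∈ N.E, N.inc e {v} + ∑ u ∈ {v}, (N.o u + N.i u))) := dvd_sum fun v _ => h1 _
  have h3 : ∑ v ∈ A, (∑ e ∈ N.E, N.inc e {v} + ∑ u ∈ {v}, (N.o u + N.i u)) =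
      ∑ e ∈ N.E, N.inc e A + ∑ v ∈ A, (N.o v + N.i v) := by
    rw [sum_add_distrib, sum_comm]
    simp [sum_inc_singleton]
  rw [sum_sub_distrib, h3] at h2
  have h4 := h1 A
  omega

lemma Valid.parity_set {k : ℤ} {N : Net V β} {S : Finset V} (h : N.Valid k S) {A : Finset V}
    (hA : A ⊆ N.U) : (2 : ℤ) ∣ N.deg A - ∑ v ∈ A, N.b v := by
  have h1 : (2 : ℤ) ∣ ∑ v ∈ A, (N.deg {v} - N.b v) := dvd_sum fun v hv => h.parity v (hA hv)
  rw [sum_sub_distrib] at h1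
  have h2 := two_dvd_deg_sub N A
  omega

lemma deg_nonneg {k : ℤ} {N : Net V β} {S : Finset V} (h : N.Valid k S) (A : Finset V) :
    0 ≤ N.deg A :=
  add_nonneg (sum_nonneg fun _ _ => abs_nonneg _)
    (sum_nonneg fun v _ => add_nonneg (h.o_nonneg v) (h.i_nonneg v))

/-- A set that has slack but is not loose is tight. -/
lemma Valid.tight_of_not_slack {k : ℤ} {N : Net V β} {S : Finset V} (h : N.Valid k S)
    {A : Finset V} (hA : A ⊆ N.U) (hn : ¬ N.Slack k (2 * k) A) (m : ℤ) :
    N.deg A ≤ 2 * k - 2 + |∑ v ∈ A, N.b v + 2 * k * m| := by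
  by_contra! hlt
  apply hn
  refine ⟨m, ?_⟩
  -- Degree and admissible excesses have equal parity, so a gap above `2 * k - 2` is already `2 *
  -- k`.
  have h1 := h.parity_set hA
  have h2 := two_dvd_abs_sub (∑ v ∈ A, N.b v + 2 * k * m)
  have h3 : (2 : ℤ) ∣ 2 * k * m := ⟨k * m, by ring⟩
  omega

lemma inc_univ {k : ℤ} {N : Net V β} {S : Finset V} (h : N.Valid k S) {e : β} (he : e ∈ N.E) :
    N.inc e N.U = 0 := by
  simp [inc, ind_of_mem (h.ends e he).1, ind_of_mem (h.ends e he).2]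

lemma excess_univ {k : ℤ} {N : Net V β} {S : Finset V} (h : N.Valid k S) (σ : β → ℤ) :
    N.excess σ N.U = ∑ v ∈ N.U, (N.i v - N.o v) := by
  unfold excess
  rw [sum_eq_zero, zero_add]
  intro e he
  rw [inc_univ h he, mul_zero]

lemma inc_sdiff {k : ℤ} {N : Net V β} {S : Finset V} (h : N.Valid k S) {e : β} (he : e ∈ N.E)
    (A : Finset V) : N.inc e (N.U \ A) = - N.inc e A := by
  have h1 := (h.ends e he).1
  have h2 := (h.ends e he).2
  simp only [inc, ind, mem_sdiff, h1, h2, true_and]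
  split_ifs <;> simp_all

/-! ### Reversal -/

/-- The net with all directions reversed. -/
def rev (N : Net V β) : Net V β where
  U := N.U
  E := N.E
  s := N.t
  t := N.s
  o := N.i
  i := N.o
  b := fun v => - N.b v

lemma inc_rev (N : Net V β) (e : β) (A : Finset V) : N.rev.inc e A = - N.inc e A := by
  simp [inc, rev]

lemma deg_rev (N : Net V β) (A : Finset V) : N.rev.deg A = N.deg A := by
  simp only [deg, inc_rev, abs_neg]
  simp [rev, add_comm]

lemma excess_rev (N : Net V β) (σ : β → ℤ) (A : Finset V) :
    N.rev.excess σ A = - N.excess σ A := by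
  simp only [excess, inc_rev, mul_neg, sum_neg_distrib, neg_add]
  simp only [rev, ← sum_neg_distrib, neg_sub]

lemma Slack.of_rev {k l : ℤ} {N : Net V β} {A : Finset V} (h : N.rev.Slack k l A) :
    N.Slack k l A := by
  obtain ⟨m, hm⟩ := h
  refine ⟨-m, ?_⟩
  rw [← abs_neg, ← deg_rev]
  convert hm using 3
  simp only [Net.rev, sum_neg_distrib]
  ring

lemma Slack.rev {k l : ℤ} {N : Net V β} {A : Finset V} (h : N.Slack k l A) :
    N.rev.Slack k l A :=
  Slack.of_rev (N := N.rev) (by simpa [Net.rev] using h)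

lemma Solvable.of_rev {k : ℤ} {N : Net V β} (h : N.rev.Solvable k) : N.Solvable k := by
  obtain ⟨σ, h1, h2⟩ := h
  refine ⟨σ, h1, fun v hv => ?_⟩
  obtain ⟨h3, h4⟩ := h2 v hv
  rw [excess_rev] at h3 h4
  rw [abs_neg] at h4
  refine ⟨?_, h4⟩
  rw [show N.excess σ {v} - N.b v = -(-N.excess σ {v} - N.rev.b v) by simp only [Net.rev]; ring]
  exact h3.neg_right

lemma net_rev (N : Net V β) :
    -∑ v ∈ N.U, (N.i v - N.o v) = ∑ v ∈ N.rev.U, (N.rev.i v - N.rev.o v) := by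
  rw [← sum_neg_distrib]
  exact sum_congr rfl fun v _ => neg_sub _ _

lemma Valid.rev {k : ℤ} {N : Net V β} {S : Finset V} (h : N.Valid k S) : N.rev.Valid k S where
  ends e he := (h.ends e he).symm
  o_nonneg := h.i_nonneg
  i_nonneg := h.o_nonneg
  parity v hv := by
    rw [deg_rev]
    have := h.parity v hv
    simp only [Net.rev]
    omega
  balanced := by
    rw [← net_rev, show ∑ v ∈ N.rev.U, N.rev.b v = -∑ v ∈ N.U, N.b v from sum_neg_distrib _,
      show -∑ v ∈ N.U, N.b v - -∑ v ∈ N.U, (N.i v - N.o v) =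
        -(∑ v ∈ N.U, N.b v - ∑ v ∈ N.U, (N.i v - N.o v)) by ring]
    exact h.balanced.neg_right
  net_lt := by
    rw [← net_rev, abs_neg]
    exact h.net_lt
  upper m := by
    have := h.upper (-m)
    rw [← abs_neg] at this
    rw [← net_rev, show ∑ v ∈ N.rev.U, (N.rev.o v + N.rev.i v) = ∑ v ∈ N.U, (N.o v + N.i v) from
      sum_congr rfl fun v _ => add_comm _ _]
    convert this using 3
    ring
  lower A h1 h2 h3 h4 := (h.lower A h1 h2 h3 h4).rev
  exempt x hx := ⟨(h.exempt x hx).1, by simpa [Net.rev] using (h.exempt x hx).2⟩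
  card_le := h.card_le

end Net

namespace Net

open Finset

variable {V β : Type*} [DecidableEq V]

/-! ### Contraction -/

/-- Contract the set `A` to the vertex `a`. -/
def contract (N : Net V β) (A : Finset V) (a : V) : Net V β where
  U := insert a (N.U \ A)
  E := N.E
  s := fun e => if N.s e ∈ A then a else N.s e
  t := fun e => if N.t e ∈ A then a else N.t e
  o := fun v => if v = a then ∑ u ∈ A, N.o u else N.o v
  i := fun v => if v = a then ∑ u ∈ A, N.i u else N.i v
  b := fun v => if v = a then ∑ u ∈ A, N.b u else N.b v

/-- The preimage of a vertex set under the contraction of `A` to `a`. -/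
def pull (A : Finset V) (a : V) (B : Finset V) : Finset V := if a ∈ B then A ∪ B.erase a else B

section contract

variable {N : Net V β} {A B : Finset V} {a : V}

lemma disjoint_erase_of_subset (hB : B ⊆ insert a (N.U \ A)) : Disjoint A (B.erase a) := by
  rw [disjoint_right]
  intro v hv hvA
  rw [mem_erase] at hv
  have := hB hv.2
  simp [hv.1, hvA] at this

lemma sum_contract (hB : B ⊆ insert a (N.U \ A)) (g : V → ℤ) :
    (∑ v ∈ B, if v = a then ∑ u ∈ A, g u else g v) = ∑ v ∈ pull A a B, g v := by
  unfold pull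
  split_ifs with h
  · rw [sum_union (disjoint_erase_of_subset hB), ← add_sum_erase B _ h, if_pos rfl]
    congr 1
    exact sum_congr rfl fun v hv => if_neg (ne_of_mem_erase hv)
  · exact sum_congr rfl fun v hv => if_neg fun h' : v = a => h (h' ▸ hv)

lemma ind_contract (ha : a ∈ A) (hB : B ⊆ insert a (N.U \ A)) (v : V) :
    ind B (if v ∈ A then a else v) = ind (pull A a B) v := by
  have hd := disjoint_erase_of_subset hB
  unfold pull ind
  by_cases hv : v ∈ A
  · have hvB : v ∈ B → v = a := fun h => by
      by_contra hne
      exact disjoint_left.1 hd hv (mem_erase.2 ⟨hne, h⟩)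
    by_cases haB : a ∈ B
    · simp [hv, haB]
    · have : v ∉ B := fun h => haB (hvB h ▸ h)
      simp [hv, haB, this]
  · have hne : v ≠ a := fun h => hv (h ▸ ha)
    by_cases haB : a ∈ B <;> simp [hv, haB, hne]

lemma inc_contract (ha : a ∈ A) (hB : B ⊆ insert a (N.U \ A)) (e : β) :
    (N.contract A a).inc e B = N.inc e (pull A a B) := by
  unfold inc
  rw [← ind_contract ha hB, ← ind_contract ha hB]
  rfl

lemma sum_b_contract (hB : B ⊆ insert a (N.U \ A)) :
    ∑ v ∈ B, (N.contract A a).b v = ∑ v ∈ pull A a B, N.b v :=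
  sum_contract hB _

lemma sum_o_contract (hB : B ⊆ insert a (N.U \ A)) :
    ∑ v ∈ B, (N.contract A a).o v = ∑ v ∈ pull A a B, N.o v :=
  sum_contract hB _

lemma sum_i_contract (hB : B ⊆ insert a (N.U \ A)) :
    ∑ v ∈ B, (N.contract A a).i v = ∑ v ∈ pull A a B, N.i v :=
  sum_contract hB _

lemma sum_io_contract (hB : B ⊆ insert a (N.U \ A)) :
    ∑ v ∈ B, ((N.contract A a).i v - (N.contract A a).o v) =
      ∑ v ∈ pull A a B, (N.i v - N.o v) := by
  simp only [sum_sub_distrib, sum_o_contract hB, sum_i_contract hB]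

lemma sum_oi_contract (hB : B ⊆ insert a (N.U \ A)) :
    ∑ v ∈ B, ((N.contract A a).o v + (N.contract A a).i v) =
      ∑ v ∈ pull A a B, (N.o v + N.i v) := by
  simp only [sum_add_distrib, sum_o_contract hB, sum_i_contract hB]

lemma deg_contract (ha : a ∈ A) (hB : B ⊆ insert a (N.U \ A)) :
    (N.contract A a).deg B = N.deg (pull A a B) := by
  unfold deg
  rw [sum_oi_contract hB]
  congr 1
  exact sum_congr rfl fun e _ => by rw [inc_contract ha hB]

lemma excess_contract (ha : a ∈ A) (hB : B ⊆ insert a (N.U \ A)) (σ : β → ℤ) :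
    (N.contract A a).excess σ B = N.excess σ (pull A a B) := by
  unfold excess
  rw [sum_io_contract hB]
  congr 1
  exact sum_congr rfl fun e _ => by rw [inc_contract ha hB]

lemma pull_subset (hA : A ⊆ N.U) (hB : B ⊆ insert a (N.U \ A)) : pull A a B ⊆ N.U := by
  intro v hv
  have := @hB v
  unfold pull at hv
  split_ifs at hv with h
  · rcases mem_union.1 hv with h1 | h1
    · exact hA h1
    · have h2 := mem_erase.1 h1
      exact (mem_sdiff.1 ((mem_insert.1 (this h2.2)).resolve_left h2.1)).1
  · have h2 : v ≠ a := fun h' => h (h' ▸ hv)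
    exact (mem_sdiff.1 ((mem_insert.1 (this hv)).resolve_left h2)).1

lemma pull_univ (hA : A ⊆ N.U) (ha : a ∈ A) : pull A a (insert a (N.U \ A)) = N.U := by
  have : a ∉ N.U \ A := by simp [ha]
  rw [pull, if_pos (mem_insert_self _ _), erase_insert this, union_sdiff_of_subset hA]

lemma pull_singleton_self : pull A a {a} = A := by
  simp [pull]

lemma pull_singleton_of_ne {v : V} (h : v ≠ a) : pull A a {v} = {v} := by
  simp [pull, h.symm]

/-- Sets of the contracted net pull back to sets of the same degree and prescription. A pulled-back
set containing `A` has two elements, so it cannot be the exempt set; an exempt vertex inside `A`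
loses its status. -/
lemma Valid.contract {k : ℤ} {S : Finset V} (h : N.Valid k S) (hA : A ⊆ N.U) (ha : a ∈ A)
    (hcard : 1 < A.card) : (N.contract A a).Valid k (S \ A) where
  ends e he := by
    have h1 := h.ends e he
    simp only [Net.contract, mem_insert, mem_sdiff]
    constructor
    · by_cases h2 : N.s e ∈ A <;> simp [h2, h1.1]
    · by_cases h2 : N.t e ∈ A <;> simp [h2, h1.2]
  o_nonneg v := by
    simp only [Net.contract]
    split_ifs
    exacts [sum_nonneg fun u _ => h.o_nonneg u, h.o_nonneg v]
  i_nonneg v := by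
    simp only [Net.contract]
    split_ifs
    exacts [sum_nonneg fun u _ => h.i_nonneg u, h.i_nonneg v]
  parity v hv := by
    have hB : {v} ⊆ insert a (N.U \ A) := singleton_subset_iff.2 hv
    rw [deg_contract ha hB, ← sum_singleton (N.contract A a).b v, sum_b_contract hB]
    exact h.parity_set (pull_subset hA hB)
  balanced := by
    rw [show (N.contract A a).U = insert a (N.U \ A) from rfl, sum_b_contract subset_rfl,
      sum_io_contract subset_rfl, pull_univ hA ha]
    exact h.balanced
  net_lt := by
    rw [show (N.contract A a).U = insert a (N.U \ A) from rfl,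
      sum_io_contract subset_rfl, pull_univ hA ha]
    exact h.net_lt
  upper m := by
    rw [show (N.contract A a).U = insert a (N.U \ A) from rfl,
      sum_io_contract subset_rfl, sum_oi_contract subset_rfl, pull_univ hA ha]
    exact h.upper m
  lower B hB hne hU hS := by
    change B ⊆ insert a (N.U \ A) at hB
    change B ≠ insert a (N.U \ A) at hU
    unfold Slack
    rw [sum_b_contract hB, deg_contract ha hB]
    apply h.lower _ (pull_subset hA hB)
    · unfold pull
      split_ifs
      exacts [⟨a, by simp [ha]⟩, hne]
    · intro hp
      apply hU
      refine subset_antisymm hB ?_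
      have haU := hA ha
      rw [← hp] at haU
      unfold pull at hp haU
      split_ifs at hp haU with haB
      · refine insert_subset haB fun v hv => ?_
        rw [← hp] at hv
        simp only [mem_sdiff, mem_union, mem_erase] at hv
        tauto
      · exact absurd haU haB
    · intro hp
      unfold pull at hp
      split_ifs at hp with haB
      · have h1 := card_le_card (subset_union_left (s₁ := A) (s₂ := B.erase a))
        rw [hp] at h1
        have := h.card_le
        omega
      · apply hS
        rw [← hp, eq_comm, Finset.sdiff_eq_self_iff_disjoint, disjoint_comm]
        have := disjoint_erase_of_subset hB
        rwa [erase_eq_of_notMem haB] at this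
  exempt x hx := by
    rw [mem_sdiff] at hx
    have hne : x ≠ a := fun h' => hx.2 (h' ▸ ha)
    have h1 := h.exempt x hx.1
    simp [Net.contract, hne, h1, hx.2]
  card_le := (card_le_card sdiff_subset).trans h.card_le

end contract

/-! ### Restriction -/

/-- Restrict to the vertex set `A`, where the edges leaving `A` become outer arcs as directed
by `σ`. -/
def restrict (N : Net V β) (A : Finset V) (σ : β → ℤ) : Net V β where
  U := A
  E := {e ∈ N.E | N.s e ∈ A ∧ N.t e ∈ A}
  s := N.s
  t := N.t
  o := fun v => N.o v + ∑ e ∈ N.E with ¬(N.s e ∈ A ∧ N.t e ∈ A), max (-(σ e * N.inc e {v})) 0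
  i := fun v => N.i v + ∑ e ∈ N.E with ¬(N.s e ∈ A ∧ N.t e ∈ A), max (σ e * N.inc e {v}) 0
  b := N.b

section restrict

variable {N : Net V β} {A B : Finset V} {σ : β → ℤ}

lemma inc_restrict (e : β) : (N.restrict A σ).inc e B = N.inc e B := rfl

lemma restrict_i_sub_o (v : V) : (N.restrict A σ).i v - (N.restrict A σ).o v =
    N.i v - N.o v + ∑ e ∈ N.E with ¬(N.s e ∈ A ∧ N.t e ∈ A), σ e * N.inc e {v} := by
  have h : ∀ e, σ e * N.inc e {v} =
      max (σ e * N.inc e {v}) 0 - max (-(σ e * N.inc e {v})) 0 := fun e => by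
    generalize σ e * N.inc e {v} = z
    omega
  simp only [restrict]
  rw [sum_congr rfl fun e _ => h e, sum_sub_distrib]
  ring

lemma restrict_o_add_i (hσ : ∀ e, σ e = 1 ∨ σ e = -1) (v : V) :
    (N.restrict A σ).o v + (N.restrict A σ).i v =
    N.o v + N.i v + ∑ e ∈ N.E with ¬(N.s e ∈ A ∧ N.t e ∈ A), |N.inc e {v}| := by
  have h : ∀ e, |N.inc e {v}| =
      max (-(σ e * N.inc e {v})) 0 + max (σ e * N.inc e {v}) 0 := fun e => by
    rw [← one_mul |N.inc e {v}|, ← show |σ e| = 1 by rcases hσ e with h | h <;> simp [h], ← abs_mul]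
    generalize σ e * N.inc e {v} = z
    rcases abs_cases z with h | h <;> omega
  simp only [restrict]
  rw [sum_congr rfl fun e _ => h e, sum_add_distrib]
  ring

/-- An edge not inside `A` has at most one end in `B`, so all summands have the same sign. -/
lemma sum_abs_inc_singleton {e : β} (he : ¬(N.s e ∈ A ∧ N.t e ∈ A)) (hB : B ⊆ A) :
    ∑ v ∈ B, |N.inc e {v}| = |N.inc e B| := by
  rw [← sum_inc_singleton]
  by_cases hs : N.s e ∈ A
  · have ht : N.t e ∉ A := fun ht => he ⟨hs, ht⟩
    have h : ∀ v ∈ B, 0 ≤ N.inc e {v} := fun v hv => by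
      have : N.t e ∉ ({v} : Finset V) := fun h => ht (mem_singleton.1 h ▸ hB hv)
      rw [inc, ind_of_notMem this]
      rcases ind_cases {v} (N.s e) with h | h <;> omega
    rw [abs_of_nonneg (sum_nonneg h)]
    exact sum_congr rfl fun v hv => abs_of_nonneg (h v hv)
  · have h : ∀ v ∈ B, N.inc e {v} ≤ 0 := fun v hv => by
      have : N.s e ∉ ({v} : Finset V) := fun h => hs (mem_singleton.1 h ▸ hB hv)
      rw [inc, ind_of_notMem this]
      rcases ind_cases {v} (N.t e) with h | h <;> omega
    rw [abs_of_nonpos (sum_nonpos h), ← sum_neg_distrib]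
    exact sum_congr rfl fun v hv => abs_of_nonpos (h v hv)

lemma deg_restrict (hσ : ∀ e, σ e = 1 ∨ σ e = -1) (hB : B ⊆ A) :
    (N.restrict A σ).deg B = N.deg B := by
  unfold deg
  rw [sum_congr rfl fun v _ => restrict_o_add_i (A := A) hσ v, sum_add_distrib, sum_comm,
    sum_congr rfl fun e he => sum_abs_inc_singleton (mem_filter.1 he).2 hB,
    ← sum_filter_add_sum_filter_not N.E (fun e => N.s e ∈ A ∧ N.t e ∈ A) (fun e => |N.inc e B|)]
  simp only [inc_restrict]
  simp only [restrict]
  ring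

lemma sum_io_restrict : ∑ v ∈ B, ((N.restrict A σ).i v - (N.restrict A σ).o v) =
    ∑ v ∈ B, (N.i v - N.o v) + ∑ e ∈ N.E with ¬(N.s e ∈ A ∧ N.t e ∈ A), σ e * N.inc e B := by
  rw [sum_congr rfl fun v _ => restrict_i_sub_o v, sum_add_distrib, sum_comm]
  simp only [← mul_sum, sum_inc_singleton]

lemma excess_restrict (τ : β → ℤ) : (N.restrict A σ).excess τ B =
    N.excess (fun e => if N.s e ∈ A ∧ N.t e ∈ A then τ e else σ e) B := by
  have h1 : ∑ e ∈ N.E with (N.s e ∈ A ∧ N.t e ∈ A),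
      (if N.s e ∈ A ∧ N.t e ∈ A then τ e else σ e) * N.inc e B =
      ∑ e ∈ N.E with (N.s e ∈ A ∧ N.t e ∈ A), τ e * N.inc e B :=
    sum_congr rfl fun e he => by rw [if_pos (mem_filter.1 he).2]
  have h2 : ∑ e ∈ N.E with ¬(N.s e ∈ A ∧ N.t e ∈ A),
      (if N.s e ∈ A ∧ N.t e ∈ A then τ e else σ e) * N.inc e B =
      ∑ e ∈ N.E with ¬(N.s e ∈ A ∧ N.t e ∈ A), σ e * N.inc e B :=
    sum_congr rfl fun e he => by rw [if_neg (mem_filter.1 he).2]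
  unfold excess
  rw [sum_io_restrict, ← sum_filter_add_sum_filter_not N.E (fun e => N.s e ∈ A ∧ N.t e ∈ A)
    (fun e => (if N.s e ∈ A ∧ N.t e ∈ A then τ e else σ e) * N.inc e B), h1, h2]
  simp only [inc_restrict]
  simp only [restrict]
  ring

lemma sum_io_restrict_self : ∑ v ∈ A, ((N.restrict A σ).i v - (N.restrict A σ).o v) =
    N.excess σ A := by
  rw [sum_io_restrict, excess,
    ← sum_filter_add_sum_filter_not N.E (fun e => N.s e ∈ A ∧ N.t e ∈ A),
    sum_eq_zero (s := N.E.filter fun e => N.s e ∈ A ∧ N.t e ∈ A)]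
  · ring
  · intro e he
    have := (mem_filter.1 he).2
    simp [inc, ind_of_mem this.1, ind_of_mem this.2]

/-- After restriction all of `deg A` consists of outer arcs, and their net is the excess of `A`
under `σ`. Tightness of `A` thus turns into `upper`, and the smallness of its excess into `net_lt`.
-/
lemma Valid.restrict {k : ℤ} {S : Finset V} (h : N.Valid k S) (hA : A ⊆ N.U)
    (hσ : ∀ e, σ e = 1 ∨ σ e = -1) (hdvd : 2 * k ∣ N.excess σ A - ∑ v ∈ A, N.b v)
    (hlt : |N.excess σ A| < 2 * k)
    (htight : ∀ m : ℤ, N.deg A ≤ 2 * k - 2 + |∑ v ∈ A, N.b v + 2 * k * m|) :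
    (N.restrict A σ).Valid k (S ∩ A) where
  ends e he := (mem_filter.1 he).2
  o_nonneg v := add_nonneg (h.o_nonneg v) (sum_nonneg fun _ _ => le_max_right _ _)
  i_nonneg v := add_nonneg (h.i_nonneg v) (sum_nonneg fun _ _ => le_max_right _ _)
  parity v hv := by
    rw [deg_restrict (A := A) (B := {v}) hσ (singleton_subset_iff.2 hv)]
    exact h.parity v (hA hv)
  balanced := by
    rw [show (N.restrict A σ).U = A from rfl, sum_io_restrict_self]
    rw [← dvd_neg, neg_sub]
    exact hdvd
  net_lt := by
    rw [show (N.restrict A σ).U = A from rfl, sum_io_restrict_self]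
    exact hlt
  upper m := by
    have h1 : (N.restrict A σ).deg A = ∑ v ∈ A, ((N.restrict A σ).o v + (N.restrict A σ).i v) := by
      rw [deg, sum_eq_zero, zero_add]
      intro e he
      have := (mem_filter.1 he).2
      rw [inc_restrict]
      simp [inc, ind_of_mem this.1, ind_of_mem this.2]
    rw [show (N.restrict A σ).U = A from rfl, sum_io_restrict_self, ← h1,
      deg_restrict hσ subset_rfl]
    obtain ⟨c, hc⟩ := hdvd
    have := htight (c + m)
    rwa [show ∑ v ∈ A, N.b v + 2 * k * (c + m) = N.excess σ A + 2 * k * m by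
      rw [mul_add, ← hc]; ring] at this
  lower B hB hne hU hS := by
    change B ⊆ A at hB
    change B ≠ A at hU
    unfold Slack
    rw [deg_restrict hσ hB]
    refine h.lower B (hB.trans hA) hne ?_ ?_
    · rintro rfl
      exact hU (subset_antisymm hB hA)
    · rintro rfl
      exact hS (inter_eq_left.2 hB).symm
  exempt x hx := ⟨(mem_inter.1 hx).2, (h.exempt x (mem_inter.1 hx).1).2⟩
  card_le := (card_le_card inter_subset_left).trans h.card_le

end restrict

/-- A net is solvable if both the net where a tight set is contracted and all nets where this set
has its neighbourhood directed are. -/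
lemma Valid.solvable_of_tight {k : ℤ} {N : Net V β} {S A : Finset V} {a : V} (h : N.Valid k S)
    (hA : A ⊆ N.U) (ha : a ∈ A)
    (htight : ∀ m : ℤ, N.deg A ≤ 2 * k - 2 + |∑ v ∈ A, N.b v + 2 * k * m|)
    (h1 : (N.contract A a).Solvable k)
    (h2 : ∀ σ, (N.restrict A σ).Valid k (S ∩ A) → (N.restrict A σ).Solvable k) :
    N.Solvable k := by
  obtain ⟨σ, hσ, hσ'⟩ := h1
  have haa : {a} ⊆ insert a (N.U \ A) := by simp
  have h3 := hσ' a (by simp [Net.contract])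
  rw [excess_contract ha haa, ← sum_singleton (N.contract A a).b a, sum_b_contract haa,
    pull_singleton_self] at h3
  obtain ⟨τ, hτ, hτ'⟩ := h2 σ (h.restrict hA hσ h3.1 h3.2 htight)
  refine ⟨fun e => if N.s e ∈ A ∧ N.t e ∈ A then τ e else σ e, fun e => ?_, fun v hv => ?_⟩
  · dsimp only
    split_ifs
    exacts [hτ e, hσ e]
  · by_cases hvA : v ∈ A
    · have := hτ' v hvA
      rwa [excess_restrict] at this
    · have hne : v ≠ a := fun h' => hvA (h' ▸ ha)
      have hvU : {v} ⊆ insert a (N.U \ A) := by simp [hv, hvA]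
      have h4 := hσ' v (hvU (mem_singleton_self v))
      rw [excess_contract ha hvU, ← sum_singleton (N.contract A a).b v, sum_b_contract hvU,
        pull_singleton_of_ne hne, sum_singleton] at h4
      have h7 : N.excess (fun e => if N.s e ∈ A ∧ N.t e ∈ A then τ e else σ e) {v} =
          N.excess σ {v} := by
        unfold excess
        congr 1
        refine sum_congr rfl fun e _ => ?_
        dsimp only
        split_ifs with he
        · have h5 : N.s e ≠ v := fun h' => hvA (h' ▸ he.1)
          have h6 : N.t e ≠ v := fun h' => hvA (h' ▸ he.2)
          simp [inc, ind, h5, h6]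
        · rfl
      rwa [h7]

end Net

/-! ### Loose nets and the local reductions. -/

namespace Net

open Finset

variable {V β : Type*} [DecidableEq V]

/-- All vertex sets with at least two elements are loose. -/
def Loose (k : ℤ) (N : Net V β) : Prop :=
  ∀ A ⊆ N.U, 1 < A.card → A ≠ N.U → N.Slack k (2 * k) A

/-- The edge `e` joins `x` and `y`. -/
def Joins (N : Net V β) (e : β) (x y : V) : Prop :=
  ∃ ε : ℤ, (ε = 1 ∨ ε = -1) ∧ ∀ A, ε * N.inc e A = ind A x - ind A y

lemma Joins.symm {N : Net V β} {e : β} {x y : V} (h : N.Joins e x y) : N.Joins e y x := by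
  obtain ⟨ε, h1, h2⟩ := h
  refine ⟨-ε, by omega, fun A => ?_⟩
  rw [neg_mul, h2]
  ring

lemma Joins.abs_inc {N : Net V β} {e : β} {x y : V} (h : N.Joins e x y) (A : Finset V) :
    |N.inc e A| = |ind A x - ind A y| := by
  obtain ⟨ε, h1, h2⟩ := h
  rw [← h2, abs_mul]
  rcases h1 with rfl | rfl <;> simp

lemma joins_ends (N : Net V β) (e : β) : N.Joins e (N.s e) (N.t e) :=
  ⟨1, Or.inl rfl, fun A => by simp [inc]⟩

lemma Valid.exists_joins {k : ℤ} {N : Net V β} {S : Finset V} (h : N.Valid k S) {e : β}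
    (he : e ∈ N.E) {x : V} (hx : N.inc e {x} ≠ 0) : ∃ y ∈ N.U, y ≠ x ∧ N.Joins e x y := by
  have h1 := h.ends e he
  have h2 := N.joins_ends e
  unfold inc at hx
  rcases ind_cases {x} (N.s e) with h3 | h3 <;> rcases ind_cases {x} (N.t e) with h4 | h4
  · omega
  · rw [mem_singleton] at h3 h4
    exact ⟨N.t e, h1.2, h4.1, h3.1 ▸ h2⟩
  · rw [mem_singleton] at h3 h4
    exact ⟨N.s e, h1.1, h3.1, h4.1 ▸ h2.symm⟩
  · omega

/-- Validity passes to a net with slightly smaller degrees if all sets with at least two elements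
are loose. -/
lemma Valid.step {k : ℤ} {N N' : Net V β} {S : Finset V} (h : N.Valid k S) (hl : N.Loose k)
    (hU : N'.U = N.U) (ends : ∀ e ∈ N'.E, N'.s e ∈ N.U ∧ N'.t e ∈ N.U)
    (o_nonneg : ∀ v, 0 ≤ N'.o v) (i_nonneg : ∀ v, 0 ≤ N'.i v)
    (parity : ∀ v, (2 : ℤ) ∣ (N'.deg {v} - N.deg {v}) - (N'.b v - N.b v))
    (balanced : ∑ v ∈ N.U, N'.b v - ∑ v ∈ N.U, (N'.i v - N'.o v) =
      ∑ v ∈ N.U, N.b v - ∑ v ∈ N.U, (N.i v - N.o v))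
    (net_lt : |∑ v ∈ N.U, (N'.i v - N'.o v)| < 2 * k)
    (upper : ∀ m : ℤ, ∑ v ∈ N.U, (N'.o v + N'.i v) ≤
      2 * k - 2 + |∑ v ∈ N.U, (N'.i v - N'.o v) + 2 * k * m|)
    (exempt : ∀ x ∈ S, N'.b x = N.b x)
    (lower : ∀ A ⊆ N.U, |∑ v ∈ A, N'.b v - ∑ v ∈ A, N.b v| ≤ N'.deg A - N.deg A + 2)
    (single : ∀ x ∈ N.U, {x} ≠ N.U → {x} ≠ S → N'.Slack k (2 * k - 2) {x}) :
    N'.Valid k S where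
  ends := by rwa [hU]
  o_nonneg := o_nonneg
  i_nonneg := i_nonneg
  parity v hv := by
    rw [hU] at hv
    have h1 := h.parity v hv
    have h2 := parity v
    omega
  balanced := by
    rw [hU, balanced]
    exact h.balanced
  net_lt := by rwa [hU]
  upper := by rwa [hU]
  lower A hA hne hAU hAS := by
    rw [hU] at hA hAU
    by_cases hc : 1 < A.card
    · obtain ⟨m, hm⟩ := hl A hA hc hAU
      refine ⟨m, ?_⟩
      have h1 := lower A hA
      have h2 := abs_add_le (∑ v ∈ A, N.b v + 2 * k * m) (∑ v ∈ A, N'.b v - ∑ v ∈ A, N.b v)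
      rw [show ∑ v ∈ A, N.b v + 2 * k * m + (∑ v ∈ A, N'.b v - ∑ v ∈ A, N.b v) =
        ∑ v ∈ A, N'.b v + 2 * k * m by ring] at h2
      linarith
    · obtain ⟨x, rfl⟩ := card_eq_one.1 (le_antisymm (not_lt.1 hc) hne.card_pos)
      exact single x (singleton_subset_iff.1 hA) hAU hAS
  exempt x hx := by
    rw [hU, exempt x hx]
    exact h.exempt x hx
  card_le := h.card_le

lemma Slack.mono {k l l' : ℤ} {N N' : Net V β} {A : Finset V} (h : N.Slack k l A)
    (hb : ∑ v ∈ A, N'.b v = ∑ v ∈ A, N.b v) (hd : N.deg A - l ≤ N'.deg A - l') :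
    N'.Slack k l' A := by
  obtain ⟨m, hm⟩ := h
  refine ⟨m, ?_⟩
  rw [hb]
  linarith

lemma abs_ind_sub_le (A : Finset V) (x y : V) : |ind A x - ind A y| ≤ 1 := by
  rcases ind_cases A x with h | h <;> rcases ind_cases A y with h' | h' <;> simp [h.2, h'.2]

lemma abs_ind_sub_self (x y : V) (h : y ≠ x) : |ind {x} x - ind {x} y| = 1 := by
  simp [ind, h]

variable [DecidableEq β]

/-! ### Lifting two edges -/

/-- Replace two edges from a vertex to `y` and `z` by an edge between `y` and `z`. -/
def lift (N : Net V β) (e₁ e₂ : β) (y z : V) : Net V β :=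
  { N with
    E := N.E.erase e₂
    s := Function.update N.s e₁ z
    t := Function.update N.t e₁ y }

section lift

variable {N : Net V β} {e₁ e₂ : β} {x y z : V}

lemma inc_lift_self (A : Finset V) : (N.lift e₁ e₂ y z).inc e₁ A = ind A z - ind A y := by
  simp [inc, lift]

lemma inc_lift_of_ne {e : β} (he : e ≠ e₁) (A : Finset V) :
    (N.lift e₁ e₂ y z).inc e A = N.inc e A := by
  simp [inc, lift, he]

lemma deg_lift (h₁ : e₁ ∈ N.E) (h₂ : e₂ ∈ N.E) (hne : e₁ ≠ e₂) (hxy : N.Joins e₁ x y)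
    (hxz : N.Joins e₂ x z) (A : Finset V) : (N.lift e₁ e₂ y z).deg A =
    N.deg A - |ind A x - ind A y| - |ind A x - ind A z| + |ind A z - ind A y| := by
  have h3 : e₁ ∈ N.E.erase e₂ := mem_erase.2 ⟨hne, h₁⟩
  unfold deg
  rw [← add_sum_erase N.E _ h₂, ← add_sum_erase _ _ h3,
    show (N.lift e₁ e₂ y z).E = N.E.erase e₂ from rfl,
    ← add_sum_erase _ (fun e => |(N.lift e₁ e₂ y z).inc e A|) h3,
    inc_lift_self, hxy.abs_inc, hxz.abs_inc,
    sum_congr rfl fun e he => by rw [inc_lift_of_ne (ne_of_mem_erase he)]]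
  simp only [lift]
  ring

/-- The two old edges are directed as a path through `x` that follows the new edge, so they cancel
at `x`. -/
lemma Solvable.of_lift {k : ℤ} (h₁ : e₁ ∈ N.E) (h₂ : e₂ ∈ N.E) (hne : e₁ ≠ e₂)
    (hxy : N.Joins e₁ x y) (hxz : N.Joins e₂ x z) (h : (N.lift e₁ e₂ y z).Solvable k) :
    N.Solvable k := by
  obtain ⟨ε₁, hε₁, hi₁⟩ := hxy
  obtain ⟨ε₂, hε₂, hi₂⟩ := hxz.symm
  obtain ⟨σ, hσ, hσ'⟩ := h
  have h3 : e₁ ∈ N.E.erase e₂ := mem_erase.2 ⟨hne, h₁⟩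
  set τ : β → ℤ := fun e => if e = e₁ then ε₁ * σ e₁ else if e = e₂ then ε₂ * σ e₁ else σ e
  have key : ∀ A, N.excess τ A = (N.lift e₁ e₂ y z).excess σ A := fun A => by
    unfold excess
    rw [← add_sum_erase N.E _ h₂, ← add_sum_erase _ _ h3,
      show (N.lift e₁ e₂ y z).E = N.E.erase e₂ from rfl,
      ← add_sum_erase _ (fun e => σ e * (N.lift e₁ e₂ y z).inc e A) h3, inc_lift_self]
    have h4 : ∑ e ∈ (N.E.erase e₂).erase e₁, τ e * N.inc e A =
        ∑ e ∈ (N.E.erase e₂).erase e₁, σ e * (N.lift e₁ e₂ y z).inc e A := by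
      refine sum_congr rfl fun e he => ?_
      simp only [mem_erase] at he
      rw [inc_lift_of_ne he.1]
      simp [τ, he.1, he.2.1]
    rw [h4]
    simp only [τ, if_pos, if_neg hne.symm]
    have h5 := hi₁ A
    have h6 := hi₂ A
    simp only [lift]
    linear_combination σ e₁ * h5 + σ e₁ * h6
  refine ⟨τ, fun e => ?_, fun v hv => ?_⟩
  · simp only [τ]
    have := hσ e₁
    have := hσ e
    split_ifs
    · rcases hε₁ with rfl | rfl <;> omega
    · rcases hε₂ with rfl | rfl <;> omega
    · assumption
  · rw [key]
    exact hσ' v hv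

/-- Every set loses at most two. A single vertex other than `x` loses nothing, unless `y = z`: then
the new edge is a loop and `y` loses two, which is why `hyz` is needed. -/
lemma Valid.lift {k : ℤ} {S : Finset V} (h : N.Valid k S) (hl : N.Loose k) (h₁ : e₁ ∈ N.E)
    (h₂ : e₂ ∈ N.E) (hne : e₁ ≠ e₂) (hxy : N.Joins e₁ x y) (hxz : N.Joins e₂ x z)
    (hyU : y ∈ N.U) (hzU : z ∈ N.U) (hyx : y ≠ x) (hzx : z ≠ x)
    (hx : {x} = S ∨ N.Slack k (2 * k) {x})
    (hyz : y = z → {y} = S ∨ N.Slack k (2 * k) {y}) : (N.lift e₁ e₂ y z).Valid k S := by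
  have hd := deg_lift h₁ h₂ hne hxy hxz
  have hd2 : ∀ A, N.deg A - 2 ≤ (N.lift e₁ e₂ y z).deg A := fun A => by
    rw [hd]
    have := abs_ind_sub_le A x y
    have := abs_ind_sub_le A x z
    have := abs_nonneg (ind A z - ind A y)
    linarith
  refine h.step hl rfl ?_ h.o_nonneg h.i_nonneg (fun v => ?_) rfl h.net_lt h.upper
    (fun _ _ => rfl) (fun A _ => ?_) (fun v hv hvU hvS => ?_)
  · intro e he
    have h3 := h.ends e (mem_of_mem_erase he)
    simp only [Net.lift, Function.update_apply]
    constructor <;> split_ifs <;> simp [h3, hyU, hzU]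
  · rw [hd]
    have h3 := two_dvd_abs_sub (ind {v} x - ind {v} y)
    have h4 := two_dvd_abs_sub (ind {v} x - ind {v} z)
    have h5 := two_dvd_abs_sub (ind {v} z - ind {v} y)
    simp only [Net.lift]
    omega
  · have := hd2 A
    simp only [Net.lift, sub_self, abs_zero] at this ⊢
    linarith
  · by_cases hs : N.Slack k (2 * k) {v}
    · exact hs.mono rfl (by linarith [hd2 {v}])
    · have h3 : v ≠ x := by
        rintro rfl
        exact hx.elim hvS hs
      refine (h.lower {v} (singleton_subset_iff.2 hv) (singleton_nonempty v) hvU hvS).mono rfl ?_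
      rw [hd]
      have h4 : ind {v} x = 0 := by simp [ind, h3.symm]
      rw [h4]
      by_cases hy : y = v
      · by_cases hz : z = v
        · subst hy
          exact ((hyz hz.symm).elim hvS hs).elim
        · simp [ind, hy, hz]
      · by_cases hz : z = v <;> simp [ind, hy, hz]

end lift

/-! ### Lifting an edge and an outer arc -/

/-- Replace an edge between `x` and `y` and an outer arc into `x` by an outer arc into `y`. -/
def moveArc (N : Net V β) (e : β) (x y : V) : Net V β :=
  { N with
    E := N.E.erase e
    o := fun v => N.o v + (if v = y then 1 else 0) - (if v = x then 1 else 0) }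

section moveArc

variable {N : Net V β} {e : β} {x y : V}

lemma sum_o_moveArc (A : Finset V) :
    ∑ v ∈ A, (N.moveArc e x y).o v = ∑ v ∈ A, N.o v + ind A y - ind A x := by
  simp only [moveArc, sum_sub_distrib, sum_add_distrib, sum_ite_eq_ind, one_mul]

lemma deg_moveArc (he : e ∈ N.E) (hxy : N.Joins e x y) (A : Finset V) :
    (N.moveArc e x y).deg A = N.deg A - |ind A x - ind A y| + ind A y - ind A x := by
  unfold deg
  rw [sum_add_distrib, sum_add_distrib, sum_o_moveArc, ← add_sum_erase N.E _ he, hxy.abs_inc]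
  simp only [moveArc]
  simp only [inc]
  ring

/-- The edge is directed from `x` to `y`, so that it continues the outer arc entering `x`. -/
lemma Solvable.of_moveArc {k : ℤ} (he : e ∈ N.E) (hxy : N.Joins e x y)
    (h : (N.moveArc e x y).Solvable k) : N.Solvable k := by
  obtain ⟨ε, hε, hi⟩ := hxy
  obtain ⟨σ, hσ, hσ'⟩ := h
  have key : ∀ A, N.excess (Function.update σ e ε) A = (N.moveArc e x y).excess σ A := fun A => by
    unfold excess
    rw [sum_sub_distrib, sum_sub_distrib, sum_o_moveArc, ← add_sum_erase N.E _ he,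
      Function.update_self, hi, sum_congr rfl fun f hf => by
        rw [Function.update_of_ne (ne_of_mem_erase hf)]]
    simp only [moveArc]
    simp only [inc]
    ring
  refine ⟨Function.update σ e ε, fun f => ?_, fun v hv => ?_⟩
  · rw [Function.update_apply]
    split_ifs
    exacts [hε, hσ f]
  · rw [key]
    exact hσ' v hv

lemma Valid.moveArc {k : ℤ} {S : Finset V} (h : N.Valid k S) (hl : N.Loose k) (he : e ∈ N.E)
    (hxy : N.Joins e x y) (hxU : x ∈ N.U) (hyU : y ∈ N.U) (ho : 0 < N.o x)
    (hx : {x} = S ∨ N.Slack k (2 * k) {x}) : (N.moveArc e x y).Valid k S := by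
  have hd := deg_moveArc he hxy
  have hd2 : ∀ A, N.deg A - 2 ≤ (N.moveArc e x y).deg A := fun A => by
    rw [hd]
    rcases ind_cases A x with h1 | h1 <;> rcases ind_cases A y with h2 | h2 <;> simp [h1.2, h2.2]
  have ho' := sum_o_moveArc (N := N) (e := e) (x := x) (y := y) N.U
  rw [ind_of_mem hxU, ind_of_mem hyU, add_sub_cancel_right] at ho'
  have hio : ∑ v ∈ N.U, ((N.moveArc e x y).i v - (N.moveArc e x y).o v) =
      ∑ v ∈ N.U, (N.i v - N.o v) := by
    rw [sum_sub_distrib, sum_sub_distrib, ho']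
    rfl
  have hoi : ∑ v ∈ N.U, ((N.moveArc e x y).o v + (N.moveArc e x y).i v) =
      ∑ v ∈ N.U, (N.o v + N.i v) := by
    rw [sum_add_distrib, sum_add_distrib, ho']
    rfl
  refine h.step hl rfl (fun f hf => h.ends f (mem_of_mem_erase hf)) (fun v => ?_) h.i_nonneg
    (fun v => ?_) (by rw [hio]; rfl) (by rw [hio]; exact h.net_lt)
    (by rw [hio, hoi]; exact h.upper) (fun _ _ => rfl) (fun A _ => ?_) (fun v hv hvU hvS => ?_)
  · have := h.o_nonneg v
    simp only [Net.moveArc]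
    split_ifs <;> subst_vars <;> omega
  · rw [hd]
    have h3 := two_dvd_abs_sub (ind {v} x - ind {v} y)
    simp only [Net.moveArc]
    omega
  · have := hd2 A
    simp only [Net.moveArc, sub_self, abs_zero] at this ⊢
    linarith
  · by_cases hs : N.Slack k (2 * k) {v}
    · exact hs.mono rfl (by linarith [hd2 {v}])
    · have h3 : v ≠ x := by
        rintro rfl
        exact hx.elim hvS hs
      refine (h.lower {v} (singleton_subset_iff.2 hv) (singleton_nonempty v) hvU hvS).mono rfl ?_
      rw [hd]
      have h4 : ind {v} x = 0 := by simp [ind, h3.symm]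
      rw [h4]
      rcases ind_cases {v} y with h5 | h5 <;> simp [h5.2]

end moveArc

/-! ### Deleting a directed edge -/

/-- Delete an edge directed from `y` to `x` after adding `j` outer arcs out of `x`. -/
def deleteEdge (N : Net V β) (e : β) (x y : V) (j : ℤ) : Net V β :=
  { N with
    E := N.E.erase e
    i := fun v => N.i v + (if v = x then j else 0)
    b := fun v => N.b v + (if v = x then j + 1 else 0) - (if v = y then 1 else 0) }

section deleteEdge

variable {N : Net V β} {e : β} {x y : V} {j : ℤ}

lemma sum_i_deleteEdge (A : Finset V) :
    ∑ v ∈ A, (N.deleteEdge e x y j).i v = ∑ v ∈ A, N.i v + j * ind A x := by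
  simp only [deleteEdge, sum_add_distrib, sum_ite_eq_ind]

lemma sum_b_deleteEdge (A : Finset V) : ∑ v ∈ A, (N.deleteEdge e x y j).b v =
    ∑ v ∈ A, N.b v + (j + 1) * ind A x - ind A y := by
  simp only [deleteEdge, sum_sub_distrib, sum_add_distrib, sum_ite_eq_ind, one_mul]

lemma deg_deleteEdge (he : e ∈ N.E) (hxy : N.Joins e y x) (A : Finset V) :
    (N.deleteEdge e x y j).deg A = N.deg A - |ind A y - ind A x| + j * ind A x := by
  unfold deg
  rw [sum_add_distrib, sum_add_distrib, sum_i_deleteEdge, ← add_sum_erase N.E _ he, hxy.abs_inc]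
  simp only [deleteEdge]
  simp only [inc]
  ring

/-- Restoring the edge and dropping the added arcs shifts the excesses at both ends; `hx` and `hy`
say that they stay smaller than `2 * k`. -/
lemma Solvable.of_deleteEdge {k : ℤ} (he : e ∈ N.E) (hxy : N.Joins e y x) (hne : y ≠ x)
    (hx : ∀ f : ℤ, 2 * k ∣ f - (N.b x + j + 1) → |f| < 2 * k → |f - j - 1| < 2 * k)
    (hy : ∀ f : ℤ, 2 * k ∣ f - (N.b y - 1) → |f| < 2 * k → |f + 1| < 2 * k)
    (h : (N.deleteEdge e x y j).Solvable k) : N.Solvable k := by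
  obtain ⟨ε, hε, hi⟩ := hxy
  obtain ⟨σ, hσ, hσ'⟩ := h
  have key : ∀ A, N.excess (Function.update σ e ε) A =
      (N.deleteEdge e x y j).excess σ A - (j + 1) * ind A x + ind A y := fun A => by
    unfold excess
    rw [sum_sub_distrib, sum_sub_distrib, sum_i_deleteEdge, ← add_sum_erase N.E _ he,
      Function.update_self, hi, sum_congr rfl fun f hf => by
        rw [Function.update_of_ne (ne_of_mem_erase hf)]]
    simp only [deleteEdge]
    simp only [inc]
    ring
  refine ⟨Function.update σ e ε, fun f => ?_, fun v hv => ?_⟩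
  · rw [Function.update_apply]
    split_ifs
    exacts [hε, hσ f]
  · obtain ⟨h1, h2⟩ := hσ' v hv
    rw [key]
    set f := (N.deleteEdge e x y j).excess σ {v}
    by_cases hvx : v = x
    · subst hvx
      have h3 : ind {v} v = 1 := by simp [ind]
      have h4 : ind {v} y = 0 := by simp [ind, hne]
      have h5 : (N.deleteEdge e v y j).b v = N.b v + j + 1 := by
        simp [deleteEdge, hne.symm]; ring
      rw [h5] at h1
      rw [h3, h4, show f - (j + 1) * 1 + 0 = f - j - 1 by ring]
      refine ⟨?_, hx f h1 h2⟩
      rwa [show f - j - 1 - N.b v = f - (N.b v + j + 1) by ring]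
    · by_cases hvy : v = y
      · subst hvy
        have h3 : ind {v} v = 1 := by simp [ind]
        have h4 : ind {v} x = 0 := by simp [ind, hne.symm]
        have h5 : (N.deleteEdge e x v j).b v = N.b v - 1 := by
          simp [deleteEdge, hne]
        rw [h5] at h1
        rw [h3, h4, show f - (j + 1) * 0 + 1 = f + 1 by ring]
        refine ⟨?_, hy f h1 h2⟩
        rwa [show f + 1 - N.b v = f - (N.b v - 1) by ring]
      · have h3 : ind {v} x = 0 := by simp [ind, Ne.symm hvx]
        have h4 : ind {v} y = 0 := by simp [ind, Ne.symm hvy]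
        have h5 : (N.deleteEdge e x y j).b v = N.b v := by
          simp [deleteEdge, hvx, hvy]
        rw [h5] at h1
        rw [h3, h4, show f - (j + 1) * 0 + 0 = f by ring]
        exact ⟨h1, h2⟩

/-- The `j` new arcs raise degree and prescription alike, so only the deleted edge costs anything,
and it costs a set at most two. Only the ends have to be checked separately. -/
lemma Valid.deleteEdge {k : ℤ} (h : N.Valid k ∅) (hl : N.Loose k) (he : e ∈ N.E)
    (hxy : N.Joins e y x) (hne : y ≠ x) (hxU : x ∈ N.U) (hyU : y ∈ N.U) (hj : 0 ≤ j)
    (hx : ∃ m, |N.b x + j + 1 + 2 * k * m| + (2 * k - 2) ≤ N.deg {x} + j - 1)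
    (hy : ∃ m, |N.b y - 1 + 2 * k * m| + (2 * k - 2) ≤ N.deg {y} - 1)
    (net_lt : |∑ v ∈ N.U, (N.i v - N.o v) + j| < 2 * k)
    (upper : ∀ m : ℤ, ∑ v ∈ N.U, (N.o v + N.i v) + j ≤
      2 * k - 2 + |∑ v ∈ N.U, (N.i v - N.o v) + j + 2 * k * m|) :
    (N.deleteEdge e x y j).Valid k ∅ := by
  have hd := deg_deleteEdge (j := j) he hxy
  have hb := sum_b_deleteEdge (N := N) (e := e) (x := x) (y := y) (j := j)
  have hi := sum_i_deleteEdge (N := N) (e := e) (x := x) (y := y) (j := j) N.U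
  rw [ind_of_mem hxU, mul_one] at hi
  have hio : ∑ v ∈ N.U, ((N.deleteEdge e x y j).i v - (N.deleteEdge e x y j).o v) =
      ∑ v ∈ N.U, (N.i v - N.o v) + j := by
    rw [sum_sub_distrib, sum_sub_distrib, hi]
    simp only [Net.deleteEdge]
    ring
  have hoi : ∑ v ∈ N.U, ((N.deleteEdge e x y j).o v + (N.deleteEdge e x y j).i v) =
      ∑ v ∈ N.U, (N.o v + N.i v) + j := by
    rw [sum_add_distrib, sum_add_distrib, hi]
    simp only [Net.deleteEdge]
    ring
  have hxx : ind {x} x = 1 := by simp [ind]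
  have hyy : ind {y} y = 1 := by simp [ind]
  have hxy' : ind {x} y = 0 := by simp [ind, hne]
  have hyx' : ind {y} x = 0 := by simp [ind, hne.symm]
  refine h.step hl rfl (fun f hf => h.ends f (mem_of_mem_erase hf)) h.o_nonneg (fun v => ?_)
    (fun v => ?_) ?_ (by rw [hio]; exact net_lt)
    (by rw [hio, hoi]; exact upper) (by simp) (fun A _ => ?_) (fun v hv hvU hvS => ?_)
  · have := h.i_nonneg v
    simp only [Net.deleteEdge]
    split_ifs <;> omega
  · have h1 := hb {v}
    simp only [sum_singleton] at h1
    rw [hd, h1]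
    have h3 := two_dvd_abs_sub (ind {v} y - ind {v} x)
    rcases ind_cases {v} x with h5 | h5 <;> rw [h5.2] at h3 ⊢ <;> omega
  · rw [hio, hb, ind_of_mem hxU, ind_of_mem hyU]
    ring
  · rw [hb, hd]
    rcases ind_cases A x with h5 | h5 <;> rcases ind_cases A y with h6 | h6 <;>
      rw [h5.2, h6.2] <;> norm_num <;> rw [abs_le] <;> constructor <;> linarith
  · unfold Slack
    rw [hb, hd]
    simp only [sum_singleton]
    by_cases hvx : v = x
    · subst hvx
      obtain ⟨m, hm⟩ := hx
      refine ⟨m, ?_⟩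
      rw [hxx, hxy', show N.b v + (j + 1) * 1 - 0 + 2 * k * m = N.b v + j + 1 + 2 * k * m by ring]
      norm_num
      linarith
    · by_cases hvy : v = y
      · subst hvy
        obtain ⟨m, hm⟩ := hy
        refine ⟨m, ?_⟩
        rw [hyy, hyx', show N.b v + (j + 1) * 0 - 1 + 2 * k * m = N.b v - 1 + 2 * k * m by ring]
        norm_num
        linarith
      · obtain ⟨m, hm⟩ := h.lower {v} (singleton_subset_iff.2 hv) (singleton_nonempty v) hvU hvS
        refine ⟨m, ?_⟩
        have h3 : ind {v} x = 0 := by simp [ind, Ne.symm hvx]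
        have h4 : ind {v} y = 0 := by simp [ind, Ne.symm hvy]
        rw [h3, h4]
        simp only [sum_singleton] at hm
        norm_num
        linarith

end deleteEdge

/-! ### Deleting an outer arc -/

omit [DecidableEq β]

/-- Delete an outer arc into `x`. -/
def deleteArc (N : Net V β) (x : V) : Net V β :=
  { N with
    o := fun v => N.o v - (if v = x then 1 else 0)
    b := fun v => N.b v + (if v = x then 1 else 0) }

section deleteArc

variable {N : Net V β} {x : V}

lemma sum_o_deleteArc (A : Finset V) :
    ∑ v ∈ A, (N.deleteArc x).o v = ∑ v ∈ A, N.o v - ind A x := by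
  simp only [deleteArc, sum_sub_distrib, sum_ite_eq_ind, one_mul]

lemma sum_b_deleteArc (A : Finset V) :
    ∑ v ∈ A, (N.deleteArc x).b v = ∑ v ∈ A, N.b v + ind A x := by
  simp only [deleteArc, sum_add_distrib, sum_ite_eq_ind, one_mul]

lemma deg_deleteArc (A : Finset V) : (N.deleteArc x).deg A = N.deg A - ind A x := by
  unfold deg
  rw [sum_add_distrib, sum_add_distrib, sum_o_deleteArc]
  simp only [deleteArc]
  simp only [inc]
  ring

lemma Solvable.of_deleteArc {k : ℤ}
    (hx : ∀ f : ℤ, 2 * k ∣ f - (N.b x + 1) → |f| < 2 * k → |f - 1| < 2 * k)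
    (h : (N.deleteArc x).Solvable k) : N.Solvable k := by
  obtain ⟨σ, hσ, hσ'⟩ := h
  have key : ∀ A, N.excess σ A = (N.deleteArc x).excess σ A - ind A x := fun A => by
    unfold excess
    rw [sum_sub_distrib, sum_sub_distrib, sum_o_deleteArc]
    simp only [deleteArc]
    simp only [inc]
    ring
  refine ⟨σ, hσ, fun v hv => ?_⟩
  obtain ⟨h1, h2⟩ := hσ' v hv
  rw [key]
  set f := (N.deleteArc x).excess σ {v}
  by_cases hvx : v = x
  · subst hvx
    have h3 : ind {v} v = 1 := by simp [ind]
    have h5 : (N.deleteArc v).b v = N.b v + 1 := by simp [deleteArc]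
    rw [h5] at h1
    rw [h3]
    refine ⟨?_, hx f h1 h2⟩
    rwa [show f - 1 - N.b v = f - (N.b v + 1) by ring]
  · have h3 : ind {v} x = 0 := by simp [ind, Ne.symm hvx]
    have h5 : (N.deleteArc x).b v = N.b v := by simp [deleteArc, hvx]
    rw [h5] at h1
    rw [h3, sub_zero]
    exact ⟨h1, h2⟩

lemma Valid.deleteArc {k : ℤ} (h : N.Valid k ∅) (hl : N.Loose k) (hxU : x ∈ N.U) (ho : 0 < N.o x)
    (hx : ∃ m, |N.b x + 1 + 2 * k * m| + (2 * k - 2) ≤ N.deg {x} - 1) :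
    (N.deleteArc x).Valid k ∅ := by
  have hd := deg_deleteArc (N := N) (x := x)
  have hb := sum_b_deleteArc (N := N) (x := x)
  have ho' := sum_o_deleteArc (N := N) (x := x) N.U
  rw [ind_of_mem hxU] at ho'
  have hio : ∑ v ∈ N.U, ((N.deleteArc x).i v - (N.deleteArc x).o v) =
      ∑ v ∈ N.U, (N.i v - N.o v) + 1 := by
    rw [sum_sub_distrib, sum_sub_distrib, ho']
    simp only [Net.deleteArc]
    ring
  have hoi : ∑ v ∈ N.U, ((N.deleteArc x).o v + (N.deleteArc x).i v) =
      ∑ v ∈ N.U, (N.o v + N.i v) - 1 := by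
    rw [sum_add_distrib, sum_add_distrib, ho']
    simp only [Net.deleteArc]
    ring
  refine h.step hl rfl h.ends (fun v => ?_) h.i_nonneg (fun v => ?_) ?_ ?_ (fun m => ?_) (by simp)
    (fun A _ => ?_) (fun v hv hvU hvS => ?_)
  · have := h.o_nonneg v
    simp only [Net.deleteArc]
    split_ifs <;> subst_vars <;> omega
  · have h1 := hb {v}
    simp only [sum_singleton] at h1
    rw [hd, h1]
    omega
  · rw [hio, hb, ind_of_mem hxU]
    ring
  · rw [hio]
    -- With `m = -1`, `upper` bounds the arcs leaving the net by `2 * k - 1`. As some arc enters,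
    -- the net stays below `2 * k` when raised by one.
    have h1 := h.upper (-1)
    have h2 := h.net_lt
    have h3 : N.o x ≤ ∑ v ∈ N.U, N.o v := single_le_sum (fun v _ => h.o_nonneg v) hxU
    simp only [sum_add_distrib, sum_sub_distrib] at h1 h2 ⊢
    rw [abs_lt] at h2 ⊢
    rw [abs_of_neg (by linarith)] at h1
    constructor <;> linarith
  · rw [hio, hoi]
    have h1 := h.upper m
    have h2 := abs_sub_abs_le_abs_sub (∑ v ∈ N.U, (N.i v - N.o v) + 2 * k * m)
      (∑ v ∈ N.U, (N.i v - N.o v) + 1 + 2 * k * m)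
    rw [show ∑ v ∈ N.U, (N.i v - N.o v) + 2 * k * m -
      (∑ v ∈ N.U, (N.i v - N.o v) + 1 + 2 * k * m) = -1 by ring] at h2
    rw [abs_neg, abs_one] at h2
    linarith
  · rw [hb, hd]
    rcases ind_cases A x with h5 | h5 <;> rw [h5.2] <;> norm_num
  · unfold Slack
    rw [hb, hd]
    simp only [sum_singleton]
    by_cases hvx : v = x
    · subst hvx
      obtain ⟨m, hm⟩ := hx
      refine ⟨m, ?_⟩
      rw [show ind {v} v = 1 by simp [ind]]
      linarith
    · obtain ⟨m, hm⟩ := h.lower {v} (singleton_subset_iff.2 hv) (singleton_nonempty v) hvU hvS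
      refine ⟨m, ?_⟩
      rw [show ind {v} x = 0 by simp [ind, Ne.symm hvx]]
      simp only [sum_singleton] at hm
      norm_num
      linarith

end deleteArc

end Net

namespace Net

open Finset

variable {V β : Type*} [DecidableEq V]

/-! ### Cuts -/

lemma Valid.upper_of_dvd {k : ℤ} {N : Net V β} {S : Finset V} (h : N.Valid k S) {c : ℤ}
    (hc : 2 * k ∣ c - ∑ v ∈ N.U, N.b v) :
    ∑ v ∈ N.U, (N.o v + N.i v) ≤ 2 * k - 2 + |c| := by
  obtain ⟨m, hm⟩ := dvd_add hc h.balanced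
  have := h.upper m
  rwa [← hm, show ∑ v ∈ N.U, (N.i v - N.o v) + (c - ∑ v ∈ N.U, N.b v +
    (∑ v ∈ N.U, N.b v - ∑ v ∈ N.U, (N.i v - N.o v))) = c by ring] at this

lemma Valid.deg_add_deg_sdiff {k : ℤ} {N : Net V β} {S A : Finset V} (h : N.Valid k S)
    (hA : A ⊆ N.U) : N.deg A + N.deg (N.U \ A) =
      2 * ∑ e ∈ N.E, |N.inc e A| + ∑ v ∈ N.U, (N.o v + N.i v) := by
  unfold deg
  rw [← sum_sdiff hA, sum_congr (f := fun e => |N.inc e (N.U \ A)|) (g := fun e => |N.inc e A|) rfl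
    fun e he => by rw [inc_sdiff h he, abs_neg]]
  ring

/-- Without crossing edges, the degrees of both sides would add up to the number of outer arcs. The
lower bounds contribute `2 * k - 2` twice, while `upper` allows it once; `2 ≤ k` gives the
contradiction. -/
lemma Valid.exists_inc_ne_zero {k : ℤ} {N : Net V β} {S A : Finset V} (h : N.Valid k S)
    (hk : 2 ≤ k) (hA : A ⊆ N.U) (hne : A.Nonempty) (hAU : A ≠ N.U) (hAS : A ≠ S)
    (hAS' : N.U \ A ≠ S) : ∃ e ∈ N.E, N.inc e A ≠ 0 := by
  by_contra! hcon
  have hne' : (N.U \ A).Nonempty := sdiff_nonempty.2 fun h' => hAU (subset_antisymm hA h')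
  have hAU' : N.U \ A ≠ N.U := fun h' => by
    rw [Finset.sdiff_eq_self_iff_disjoint, disjoint_comm, disjoint_iff_inter_eq_empty,
      inter_eq_left.2 hA] at h'
    exact hne.ne_empty h'
  obtain ⟨m, hm⟩ := h.lower A hA hne hAU hAS
  obtain ⟨m', hm'⟩ := h.lower (N.U \ A) sdiff_subset hne' hAU' hAS'
  have h1 := h.deg_add_deg_sdiff hA
  rw [sum_eq_zero (s := N.E) fun e he => by rw [hcon e he, abs_zero]] at h1
  have h2 := h.upper_of_dvd (c := ∑ v ∈ A, N.b v + 2 * k * m +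
    (∑ v ∈ N.U \ A, N.b v + 2 * k * m'))
    ⟨m + m', by rw [← sum_sdiff hA]; ring⟩
  have h3 := abs_add_le (∑ v ∈ A, N.b v + 2 * k * m) (∑ v ∈ N.U \ A, N.b v + 2 * k * m')
  linarith

/-- The same count when a side may be exempt: an exempt side has prescription zero modulo `2 * k`,
so the bound for the other side alone meets `upper`, and the positive degree or the larger slack of
`x` breaks the tie. -/
lemma Valid.exists_inc_singleton_ne_zero {k : ℤ} {N : Net V β} {S : Finset V} {x : V}
    (h : N.Valid k S) (hk : 2 ≤ k) (hxU : x ∈ N.U) (hcard : 1 < N.U.card)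
    (hx : {x} = S ∨ N.Slack k (2 * k) {x}) (hdeg : 0 < N.deg {x}) :
    ∃ e ∈ N.E, N.inc e {x} ≠ 0 := by
  have hA : {x} ⊆ N.U := singleton_subset_iff.2 hxU
  have hAU : {x} ≠ N.U := fun h' => by simp [← h'] at hcard
  have hne' : (N.U \ {x}).Nonempty := sdiff_nonempty.2 fun h' => hAU (subset_antisymm hA h')
  have hAU' : N.U \ {x} ≠ N.U := fun h' => by
    rw [← h'] at hxU
    simp at hxU
  have hxS : N.U \ {x} = {x} → False := fun h' => by
    have : x ∈ N.U \ {x} := by rw [h']; exact mem_singleton_self x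
    simp at this
  by_contra! hcon
  have h1 := h.deg_add_deg_sdiff hA
  rw [sum_eq_zero (s := N.E) fun e he => by rw [hcon e he, abs_zero]] at h1
  have h2 : ∑ v ∈ N.U, N.b v = ∑ v ∈ N.U \ {x}, N.b v + N.b x := by
    rw [← sum_sdiff hA, sum_singleton]
  rcases hx with hx | ⟨m', hm'⟩
  · obtain ⟨m, hm⟩ := h.lower (N.U \ {x}) sdiff_subset hne' hAU' fun h' => hxS (h'.trans hx.symm)
    obtain ⟨c, hc⟩ := (h.exempt x (hx ▸ mem_singleton_self x)).2
    have h3 := h.upper_of_dvd (c := ∑ v ∈ N.U \ {x}, N.b v + 2 * k * m)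
      ⟨m - c, by rw [h2, hc]; ring⟩
    linarith
  · rw [sum_singleton] at hm'
    by_cases hS : N.U \ {x} = S
    · have h4 : 2 * k ∣ ∑ v ∈ N.U \ {x}, N.b v :=
        dvd_sum fun v hv => (h.exempt v (hS ▸ hv)).2
      obtain ⟨c, hc⟩ := h4
      have h3 := h.upper_of_dvd (c := N.b x + 2 * k * m') ⟨m' - c, by rw [h2, hc]; ring⟩
      have h5 := deg_nonneg h (N.U \ {x})
      linarith
    · obtain ⟨m, hm⟩ := h.lower (N.U \ {x}) sdiff_subset hne' hAU' hS
      have h3 := h.upper_of_dvd (c := ∑ v ∈ N.U \ {x}, N.b v + 2 * k * m + (N.b x + 2 * k * m'))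
        ⟨m + m', by rw [h2]; ring⟩
      have h4 := abs_add_le (∑ v ∈ N.U \ {x}, N.b v + 2 * k * m) (N.b x + 2 * k * m')
      linarith

/-! ### Nets with two vertices -/

/-- Greedy choice: each nonzero term moves the remaining target towards zero. At target zero, parity
leaves room for a step to either side. -/
lemma exists_signs {ι : Type*} [DecidableEq ι] (E : Finset ι) (c : ι → ℤ)
    (hc : ∀ e, c e = 0 ∨ c e = 1 ∨ c e = -1) (f : ℤ) (hf : |f| ≤ ∑ e ∈ E, |c e|)
    (hp : (2 : ℤ) ∣ f - ∑ e ∈ E, |c e|) :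
    ∃ σ : ι → ℤ, (∀ e, σ e = 1 ∨ σ e = -1) ∧ ∑ e ∈ E, σ e * c e = f := by
  induction E using Finset.induction_on generalizing f with
  | empty =>
    refine ⟨fun _ => 1, fun _ => Or.inl rfl, ?_⟩
    simp only [sum_empty] at hf ⊢
    exact (abs_nonpos_iff.1 hf).symm
  | insert e E he ih =>
    rw [sum_insert he] at hf hp
    have main : ∀ ε : ℤ, (ε = 1 ∨ ε = -1) → |f - ε * c e| ≤ ∑ e ∈ E, |c e| →
        (2 : ℤ) ∣ f - ε * c e - ∑ e ∈ E, |c e| →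
        ∃ σ : ι → ℤ, (∀ e, σ e = 1 ∨ σ e = -1) ∧ ∑ e ∈ insert e E, σ e * c e = f := by
      intro ε hε h1 h2
      obtain ⟨σ, hσ, hs⟩ := ih _ h1 h2
      refine ⟨Function.update σ e ε, fun d => ?_, ?_⟩
      · rw [Function.update_apply]
        split_ifs
        exacts [hε, hσ d]
      · rw [sum_insert he, Function.update_self, sum_congr (s₁ := E) (g := fun d => σ d * c d) rfl
          fun d hd => by rw [Function.update_of_ne (ne_of_mem_of_not_mem hd he)], hs]
        ring
    have hn : 0 ≤ ∑ e ∈ E, |c e| := sum_nonneg fun _ _ => abs_nonneg _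
    generalize ∑ e ∈ E, |c e| = n at *
    have hce := hc e
    by_cases hf0 : 0 < f
    · by_cases h1 : c e = -1
      · rw [h1] at hf hp main
        exact main (-1) (Or.inr rfl) (by rw [abs_le] at *; simp at hf; omega) (by simp at hp; omega)
      · refine main 1 (Or.inl rfl) ?_ ?_
        · rcases hce with h | h | h <;> rw [h] at hf ⊢ <;> simp at hf ⊢ <;> rw [abs_le] at * <;>
            omega
        · rcases hce with h | h | h <;> rw [h] at hp ⊢ <;> simp at hp ⊢ <;> omega
    · by_cases h1 : c e = -1
      · refine main 1 (Or.inl rfl) ?_ ?_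
        · rw [h1] at hf hp ⊢
          simp at hf hp ⊢
          rw [abs_le] at *
          omega
        · rw [h1] at hp ⊢
          simp at hp ⊢
          omega
      · refine main (-1) (Or.inr rfl) ?_ ?_
        · rcases hce with h | h | h <;> rw [h] at hf hp ⊢ <;> simp at hf hp ⊢ <;>
            rw [abs_le] at * <;> omega
        · rcases hce with h | h | h <;> rw [h] at hp ⊢ <;> simp at hp ⊢ <;> omega

/-- The excess `f` at `x` determines the one at `y` as the net minus `f`, so it remains to choose
`f` with both small. -/
lemma Valid.solvable_of_pair {k : ℤ} {N : Net V β} {S : Finset V} {x y : V} (h : N.Valid k S)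
    (hk : 2 ≤ k) (hU : N.U = {x, y}) (hne : y ≠ x) (hx : {x} = S ∨ N.Slack k (2 * k) {x})
    (hi : N.i x = 0) (ho : N.o x = 0) : N.Solvable k := by
  classical
  have hxU : x ∈ N.U := by simp [hU]
  have hdeg : N.deg {x} = ∑ e ∈ N.E, |N.inc e {x}| := by simp [deg, hi, ho]
  have hdeg0 := deg_nonneg h {x}
  have hnet := h.net_lt
  set net := ∑ v ∈ N.U, (N.i v - N.o v) with hnet_def
  have hf : ∃ f : ℤ, 2 * k ∣ f - N.b x ∧ |f| < 2 * k ∧ |f| ≤ N.deg {x} ∧ |net - f| < 2 * k := by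
    by_cases hb : 2 * k ∣ N.b x
    · exact ⟨0, by simpa using hb, by simp; omega, by simpa using hdeg0, by simpa using hnet⟩
    · have hs : N.Slack k (2 * k) {x} :=
        hx.resolve_left fun h' => hb (h.exempt x (h' ▸ mem_singleton_self x)).2
      obtain ⟨m, hm⟩ := hs
      have h1 := abs_nonneg (∑ v ∈ {x}, N.b v + 2 * k * m)
      have h2 := Int.emod_nonneg (N.b x) (show 2 * k ≠ 0 by omega)
      have h3 := Int.emod_lt_of_pos (N.b x) (show 0 < 2 * k by omega)
      have h4 : N.b x % (2 * k) ≠ 0 := fun h' => hb (Int.dvd_of_emod_eq_zero h')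
      have h5 : 2 * k ∣ N.b x % (2 * k) - N.b x :=
        ⟨-(N.b x / (2 * k)), by have := Int.emod_add_mul_ediv (N.b x) (2 * k); linarith⟩
      generalize N.b x % (2 * k) = r at *
      rw [abs_lt] at hnet
      by_cases hn : 0 ≤ net
      -- Of the two admissible values `r` and `r - 2 * k`, the one with the sign of the net keeps
      -- the difference below `2 * k`.
      · refine ⟨r, h5, ?_, ?_, ?_⟩
        · rw [abs_lt]; omega
        · rw [abs_le]; omega
        · rw [abs_lt]; omega
      · refine ⟨r - 2 * k, ?_, ?_, ?_, ?_⟩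
        · rw [sub_right_comm]
          exact dvd_sub h5 dvd_rfl
        · rw [abs_lt]; omega
        · rw [abs_le]; omega
        · rw [abs_lt]; omega
  obtain ⟨f, hf1, hf2, hf3, hf4⟩ := hf
  have hpar : (2 : ℤ) ∣ f - ∑ e ∈ N.E, |N.inc e {x}| := by
    rw [← hdeg]
    have h1 := h.parity x hxU
    have h2 : (2 : ℤ) ∣ f - N.b x := (dvd_mul_right 2 k).trans hf1
    omega
  obtain ⟨σ, hσ, hs⟩ := exists_signs N.E (fun e => N.inc e {x}) (fun e => abs_inc_cases N e {x}) f
    (hdeg ▸ hf3) hpar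
  have hex : N.excess σ {x} = f := by simp [excess, hi, ho, hs]
  have hey : N.excess σ {y} = net - f := by
    have h1 := sum_excess_singleton N σ N.U
    have h2 := excess_univ h σ
    rw [← h1, ← hnet_def] at h2
    rw [show ∑ v ∈ N.U, N.excess σ {v} = N.excess σ {x} + N.excess σ {y} by
      rw [hU, sum_pair hne.symm], hex] at h2
    linarith
  refine ⟨σ, hσ, fun v hv => ?_⟩
  rw [hU, mem_insert, mem_singleton] at hv
  rcases hv with rfl | rfl
  · rw [hex]
    exact ⟨hf1, hf2⟩
  · rw [hey]
    refine ⟨?_, hf4⟩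
    have h1 := h.balanced
    rw [← hnet_def, show ∑ v ∈ N.U, N.b v = N.b x + N.b v by
      rw [hU, sum_pair hne.symm]] at h1
    have h2 := dvd_add h1 hf1
    rw [← dvd_neg]
    rwa [show -(net - f - N.b v) = N.b x + N.b v - net + (f - N.b x) by ring]

/-! ### Reduction at a loose or exempt vertex -/

/-- An edge at `x` is combined with an edge to another neighbour or with an outer arc at `x`.
Otherwise all edges at `x` go to a single `y`, and two of them are lifted to a loop unless only `x`
and `y` exist. -/
lemma Valid.exists_reduction {k : ℤ} {N : Net V β} {S : Finset V} {x : V} (h : N.Valid k S)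
    (hk : 2 ≤ k) (hl : N.Loose k) (hxU : x ∈ N.U) (hcard : 1 < N.U.card)
    (hx : {x} = S ∨ N.Slack k (2 * k) {x}) (hdeg : 0 < N.deg {x})
    (ih : ∀ N' : Net V β, N'.Valid k S → N'.U = N.U → N'.E.card < N.E.card → N'.Solvable k) :
    N.Solvable k := by
  classical
  obtain ⟨e₁, h₁, hi₁⟩ := h.exists_inc_singleton_ne_zero hk hxU hcard hx hdeg
  obtain ⟨y, hyU, hyx, hxy⟩ := h.exists_joins h₁ hi₁
  by_cases hcase : ∃ e₂ ∈ N.E, ∃ z ∈ N.U, z ≠ x ∧ z ≠ y ∧ N.Joins e₂ x z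
  · obtain ⟨e₂, h₂, z, hzU, hzx, hzy, hxz⟩ := hcase
    have hne : e₁ ≠ e₂ := by
      rintro rfl
      have h3 := hxy.abs_inc {y}
      rw [hxz.abs_inc] at h3
      simp [ind, hyx.symm, hzy] at h3
    exact Solvable.of_lift h₁ h₂ hne hxy hxz
      (ih _ (h.lift hl h₁ h₂ hne hxy hxz hyU hzU hyx hzx hx fun h' => absurd h'.symm hzy) rfl
        (card_erase_lt_of_mem h₂))
  push Not at hcase
  by_cases ho : 0 < N.o x
  · exact Solvable.of_moveArc h₁ hxy
      (ih _ (h.moveArc hl h₁ hxy hxU hyU ho hx) rfl (card_erase_lt_of_mem h₁))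
  by_cases hi : 0 < N.i x
  · have hxy' : N.rev.Joins e₁ x y := by
      obtain ⟨ε, h3, h4⟩ := hxy
      refine ⟨-ε, by omega, fun A => ?_⟩
      rw [inc_rev, neg_mul_neg, h4]
    refine Solvable.of_rev (Solvable.of_moveArc (N := N.rev) h₁ hxy'
      (ih _ (h.rev.moveArc (fun A h3 h4 h5 => (hl A h3 h4 h5).rev) h₁ hxy' hxU hyU hi
        (hx.imp_right Slack.rev)) rfl (card_erase_lt_of_mem h₁)))
  have ho0 : N.o x = 0 := le_antisymm (not_lt.1 ho) (h.o_nonneg x)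
  have hi0 : N.i x = 0 := le_antisymm (not_lt.1 hi) (h.i_nonneg x)
  by_cases hU : N.U = {x, y}
  · exact h.solvable_of_pair hk hU hyx hx hi0 ho0
  have hxy_sub : {x, y} ⊆ N.U := insert_subset hxU (singleton_subset_iff.2 hyU)
  have hall : ∀ e ∈ N.E, N.inc e {x} ≠ 0 → N.Joins e x y := fun e he h3 => by
    obtain ⟨z, hzU, hzx, hxz⟩ := h.exists_joins he h3
    have : z = y := by
      by_contra hzy
      exact hcase e he z hzU hzx hzy hxz
    exact this ▸ hxz
  have hdx : N.deg {x} = ∑ e ∈ N.E, |N.inc e {x}| := by simp [deg, hi0, ho0]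
  -- An exempt vertex has even prescription, hence even degree.
  have hdeg2 : 2 ≤ N.deg {x} := by
    rcases hx with hx | ⟨m, hm⟩
    · have h3 := h.parity x hxU
      have h4 : (2 : ℤ) ∣ N.b x :=
        (dvd_mul_right 2 k).trans (h.exempt x (hx ▸ mem_singleton_self x)).2
      omega
    · have := abs_nonneg (∑ v ∈ {x}, N.b v + 2 * k * m)
      linarith
  have hsecond : ∃ e₂ ∈ N.E, e₁ ≠ e₂ ∧ N.inc e₂ {x} ≠ 0 := by
    by_contra! hcon
    rw [hdx, ← add_sum_erase _ _ h₁, sum_eq_zero fun e he => by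
      rw [hcon e (mem_of_mem_erase he) (ne_of_mem_erase he).symm, abs_zero], hxy.abs_inc,
      abs_ind_sub_self x y hyx] at hdeg2
    omega
  obtain ⟨e₂, h₂, hne, hi₂⟩ := hsecond
  have hpair : N.deg {x, y} = N.deg {y} - N.deg {x} := by
    rw [hdx]
    unfold deg
    rw [sum_pair hyx.symm, hi0, ho0, sum_singleton, add_sub_right_comm, ← sum_sub_distrib]
    congr 1
    · refine sum_congr rfl fun e he => ?_
      by_cases h3 : N.inc e {x} = 0
      · rw [h3, ← sum_inc_singleton N e {x, y}, sum_pair hyx.symm, h3]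
        simp
      · have h4 := hall e he h3
        rw [h4.abs_inc, h4.abs_inc, h4.abs_inc]
        simp [ind, hyx, hyx.symm]
    · simp
  -- Since all edges at `x` end in `y`, the degree of `y` is that of the loose pair plus that of
  -- `x`. The difference of their admissible excesses is admissible at `y`.
  have hys : N.Slack k (2 * k) {y} := by
    obtain ⟨m, hm⟩ := hl {x, y} hxy_sub (by rw [card_pair hyx.symm]; omega) (Ne.symm hU)
    rw [sum_pair hyx.symm, hpair] at hm
    unfold Slack
    simp only [sum_singleton]
    rcases hx with hx | ⟨m', hm'⟩
    · obtain ⟨c, hc⟩ := (h.exempt x (hx ▸ mem_singleton_self x)).2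
      refine ⟨m + c, ?_⟩
      rw [show N.b y + 2 * k * (m + c) = N.b x + N.b y + 2 * k * m by rw [hc]; ring]
      linarith
    · refine ⟨m - m', ?_⟩
      rw [sum_singleton] at hm'
      have h3 := abs_sub (N.b x + N.b y + 2 * k * m) (N.b x + 2 * k * m')
      rw [show N.b x + N.b y + 2 * k * m - (N.b x + 2 * k * m') = N.b y + 2 * k * (m - m') by
        ring] at h3
      linarith
  exact Solvable.of_lift h₁ h₂ hne hxy (hall e₂ h₂ hi₂)
    (ih _ (h.lift hl h₁ h₂ hne hxy (hall e₂ h₂ hi₂) hyU hyU hyx hyx hx fun _ => Or.inr hys) rfl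
      (card_erase_lt_of_mem h₂))

end Net

namespace Net

open Finset

variable {V β : Type*} [DecidableEq V]

/-! ### Nets whose vertices are tight -/

/-- The value `f + 1` could only leave the range at `2 * k`, but it is congruent to `τ`, which is
not divisible by `2 * k`. -/
lemma abs_add_one_lt_of_dvd {k τ f : ℤ} (hτ : 0 < τ) (hτk : τ ≤ k) (hf : 2 * k ∣ f - (τ - 1))
    (hlt : |f| < 2 * k) : |f + 1| < 2 * k := by
  rw [abs_lt] at *
  refine ⟨by omega, lt_of_le_of_ne (by omega) fun h => ?_⟩
  have h1 : 2 * k ∣ τ := by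
    have h2 : 2 * k ∣ f + 1 - τ := by rwa [show f + 1 - τ = f - (τ - 1) by ring]
    rw [h] at h2
    exact (dvd_sub_right dvd_rfl).1 h2
  have := Int.le_of_dvd hτ h1
  omega

lemma abs_sub_one_lt_of_dvd {k τ f : ℤ} (hτ : τ < 0) (hτk : -k ≤ τ) (hf : 2 * k ∣ f - (τ + 1))
    (hlt : |f| < 2 * k) : |f - 1| < 2 * k := by
  have h1 := abs_add_one_lt_of_dvd (k := k) (τ := -τ) (f := -f) (by omega) (by omega)
    (by rw [show -f - (-τ - 1) = -(f - (τ + 1)) by ring]; exact hf.neg_right) (by rwa [abs_neg])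
  rwa [show -f + 1 = -(f - 1) by ring, abs_neg] at h1

/-- `τ v` is the admissible excess of smallest absolute value at the tight vertex `v`. -/
structure IsTight (k : ℤ) (N : Net V β) (τ : V → ℤ) (v : V) : Prop where
  dvd : 2 * k ∣ τ v - N.b v
  deg_eq : N.deg {v} = 2 * k - 2 + |τ v|
  le : |τ v| ≤ k

lemma Valid.exists_isTight {k : ℤ} {N : Net V β} (h : N.Valid k ∅) (hcard : 1 < N.U.card)
    {v : V} (hv : v ∈ N.U) (hn : ¬ N.Slack k (2 * k) {v}) :
    ∃ t : ℤ, 2 * k ∣ t - N.b v ∧ N.deg {v} = 2 * k - 2 + |t| ∧ |t| ≤ k := by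
  have hvU : {v} ⊆ N.U := singleton_subset_iff.2 hv
  obtain ⟨m, hm⟩ := h.lower {v} hvU (singleton_nonempty v)
    (fun h' => by simp [← h'] at hcard) (by simp)
  have ht := h.tight_of_not_slack hvU hn
  simp only [sum_singleton] at hm ht
  have h0 := ht m
  -- Comparison with the two neighbouring representatives shows that `t` has the smallest size in
  -- its class, hence at most `k`.
  have h1 := ht (m + 1)
  have h2 := ht (m - 1)
  rw [show N.b v + 2 * k * (m + 1) = N.b v + 2 * k * m + 2 * k by ring] at h1
  rw [show N.b v + 2 * k * (m - 1) = N.b v + 2 * k * m - 2 * k by ring] at h2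
  refine ⟨N.b v + 2 * k * m, ⟨m, by ring⟩, by linarith, ?_⟩
  generalize N.b v + 2 * k * m = t at *
  have hlt := h.net_lt
  have := abs_nonneg (∑ v ∈ N.U, (N.i v - N.o v))
  rcases abs_cases t with h3 | h3 <;> rcases abs_cases (t + 2 * k) with h4 | h4 <;>
    rcases abs_cases (t - 2 * k) with h5 | h5 <;> omega

/-- A demand moved one unit towards zero pays for one lost unit of degree. -/
lemma IsTight.slack_sub {k : ℤ} {N : Net V β} {τ : V → ℤ} {v : V} (h : N.IsTight k τ v)
    (hpos : 0 < τ v) : ∃ m, |N.b v - 1 + 2 * k * m| + (2 * k - 2) ≤ N.deg {v} - 1 := by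
  obtain ⟨m, hm⟩ := h.dvd
  refine ⟨m, ?_⟩
  rw [← hm, h.deg_eq, show N.b v - 1 + (τ v - N.b v) = τ v - 1 by ring, abs_of_pos hpos,
    abs_of_nonneg (by omega)]
  omega

lemma IsTight.slack_add {k : ℤ} {N : Net V β} {τ : V → ℤ} {v : V} (h : N.IsTight k τ v)
    (hneg : τ v < 0) : ∃ m, |N.b v + 1 + 2 * k * m| + (2 * k - 2) ≤ N.deg {v} - 1 := by
  obtain ⟨m, hm⟩ := h.dvd
  refine ⟨m, ?_⟩
  rw [← hm, h.deg_eq, show N.b v + 1 + (τ v - N.b v) = τ v + 1 by ring, abs_of_neg hneg,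
    abs_of_nonpos (by omega)]
  omega

lemma IsTight.lt_of_pos {k : ℤ} {N : Net V β} {τ : V → ℤ} {v : V} (h : N.IsTight k τ v)
    (hpos : 0 < τ v) (f : ℤ) (hf : 2 * k ∣ f - (N.b v - 1)) (hlt : |f| < 2 * k) :
    |f + 1| < 2 * k := by
  refine abs_add_one_lt_of_dvd hpos ((le_abs_self _).trans h.le) ?_ hlt
  rw [show f - (τ v - 1) = f - (N.b v - 1) - (τ v - N.b v) by ring]
  exact dvd_sub hf h.dvd

lemma IsTight.lt_of_neg {k : ℤ} {N : Net V β} {τ : V → ℤ} {v : V} (h : N.IsTight k τ v)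
    (hneg : τ v < 0) (f : ℤ) (hf : 2 * k ∣ f - (N.b v + 1)) (hlt : |f| < 2 * k) :
    |f - 1| < 2 * k := by
  refine abs_sub_one_lt_of_dvd hneg (abs_le.1 h.le).1 ?_ hlt
  rw [show f - (τ v + 1) = f - (N.b v + 1) - (τ v - N.b v) by ring]
  exact dvd_sub hf h.dvd

lemma IsTight.rev {k : ℤ} {N : Net V β} {τ : V → ℤ} {v : V} (h : N.IsTight k τ v) :
    N.rev.IsTight k (fun v => -τ v) v where
  dvd := by
    rw [show -τ v - N.rev.b v = -(τ v - N.b v) by simp only [Net.rev]; ring]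
    exact h.dvd.neg_right
  deg_eq := by rw [deg_rev, abs_neg, h.deg_eq]
  le := by rw [abs_neg]; exact h.le

/-- An edge from a vertex of positive to a vertex of negative demand is directed and deleted. -/
lemma Valid.solvable_of_edge {k : ℤ} {N : Net V β} (h : N.Valid k ∅) (hl : N.Loose k)
    {τ : V → ℤ} (hτ : ∀ v ∈ N.U, N.IsTight k τ v) {e : β} {x y : V} (he : e ∈ N.E)
    (hxU : x ∈ N.U) (hyU : y ∈ N.U) (hyx : N.Joins e y x) (hy : 0 < τ y) (hx : τ x < 0)
    (ih : ∀ N' : Net V β, N'.Valid k ∅ → N'.U = N.U → N'.E.card < N.E.card → N'.Solvable k) :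
    N.Solvable k := by
  classical
  have hne : y ≠ x := by
    rintro rfl
    omega
  refine Solvable.of_deleteEdge (j := 0) he hyx hne (fun f h1 h2 => ?_) ((hτ y hyU).lt_of_pos hy)
    (ih _ (h.deleteEdge hl he hyx hne hxU hyU le_rfl ?_ ((hτ y hyU).slack_sub hy) ?_ ?_) rfl
      (card_erase_lt_of_mem he))
  · rw [sub_zero]
    exact (hτ x hxU).lt_of_neg hx f (by simpa using h1) h2
  · simpa using (hτ x hxU).slack_add hx
  · simpa using h.net_lt
  · simpa using h.upper

/-- If all vertices have positive demand, then the demand of one of them is raised to `k`, and an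
edge into this vertex is directed and deleted. -/
lemma Valid.solvable_of_pos {k : ℤ} {N : Net V β} (h : N.Valid k ∅) (hk : 2 ≤ k) (hl : N.Loose k)
    (hcard : 1 < N.U.card) {τ : V → ℤ} (hτ : ∀ v ∈ N.U, N.IsTight k τ v)
    (hpos : ∀ v ∈ N.U, 0 < τ v) (hi : ∀ v ∈ N.U, N.i v = 0)
    (ih : ∀ N' : Net V β, N'.Valid k ∅ → N'.U = N.U → N'.E.card < N.E.card → N'.Solvable k) :
    N.Solvable k := by
  classical
  obtain ⟨x, hxU⟩ := card_pos.1 (by omega : 0 < N.U.card)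
  have hxs : {x} ⊆ N.U := singleton_subset_iff.2 hxU
  have hxne : {x} ≠ N.U := fun h' => by simp [← h'] at hcard
  obtain ⟨e, he, hex⟩ := h.exists_inc_ne_zero hk hxs (singleton_nonempty x) hxne (by simp)
    (sdiff_nonempty.2 fun h' => hxne (subset_antisymm hxs h')).ne_empty
  obtain ⟨y, hyU, hyx, hxy⟩ := h.exists_joins he hex
  have hx := hpos x hxU
  have htx := hτ x hxU
  have hxk := htx.le
  have hdeg := htx.deg_eq
  rw [abs_of_pos hx] at hxk hdeg
  have hsi : ∑ v ∈ N.U, N.i v = 0 := sum_eq_zero hi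
  have hnet : ∑ v ∈ N.U, (N.i v - N.o v) = -∑ v ∈ N.U, N.o v := by
    rw [sum_sub_distrib, hsi, zero_sub]
  have htot : ∑ v ∈ N.U, (N.o v + N.i v) = ∑ v ∈ N.U, N.o v := by
    rw [sum_add_distrib, hsi, add_zero]
  have hO : 0 ≤ ∑ v ∈ N.U, N.o v := sum_nonneg fun v _ => h.o_nonneg v
  have hlt := h.net_lt
  rw [hnet, abs_neg, abs_of_nonneg hO] at hlt
  obtain ⟨m, hm⟩ := htx.dvd
  refine Solvable.of_deleteEdge (j := k - τ x) he hxy.symm hyx (fun f h1 h2 => ?_)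
    ((hτ y hyU).lt_of_pos (hpos y hyU))
    (ih _ (h.deleteEdge hl he hxy.symm hyx hxU hyU (by omega) ⟨m - 1, ?_⟩
      ((hτ y hyU).slack_sub (hpos y hyU)) ?_ (fun m' => ?_)) rfl
      (card_erase_lt_of_mem he))
  -- Thus `f` is `k + 1` or `1 - k`, and the original excess at `x` is `τ x` or `τ x - 2 * k`.
  · have h3 : 2 * k ∣ f - (k + 1) := by
      rw [show f - (k + 1) = f - (N.b x + (k - τ x) + 1) - (τ x - N.b x) by ring]
      exact dvd_sub h1 htx.dvd
    obtain ⟨c, hc⟩ := h3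
    rw [abs_lt] at *
    have h4 : c < 1 := by
      by_contra! h5
      nlinarith
    have h5 : -2 < c := by
      by_contra! h5
      nlinarith
    obtain rfl | rfl : c = 0 ∨ c = -1 := by omega
    all_goals constructor <;> linarith
  -- Once raised to `k`, the demand may grow by one more: `k + 1` is congruent to `1 - k`, of size
  -- only `k - 1`, which matches the lost edge.
  · rw [show N.b x + (k - τ x) + 1 + 2 * k * (m - 1) =
      N.b x + 2 * k * m - τ x + (1 - k) by ring, ← hm, hdeg,
      show N.b x + (τ x - N.b x) - τ x + (1 - k) = 1 - k by ring, abs_of_neg (by omega)]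
    linarith
  · rw [hnet, abs_lt]
    omega
  · rw [hnet, htot]
    generalize ∑ v ∈ N.U, N.o v = O at *
    -- At most `k - 1` arcs are added, as `τ x` is positive, and fewer than `2 * k` were present.
    rcases lt_trichotomy m' 0 with h3 | rfl | h3
    · have h4 : 2 * k * m' ≤ -(2 * k) := by nlinarith
      have := neg_abs_le (-O + (k - τ x) + 2 * k * m')
      omega
    · rw [mul_zero, add_zero]
      have := neg_abs_le (-O + (k - τ x))
      have := le_abs_self (-O + (k - τ x))
      omega
    · have h4 : 2 * k ≤ 2 * k * m' := by nlinarith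
      have := le_abs_self (-O + (k - τ x) + 2 * k * m')
      omega

lemma Valid.solvable_of_nonpos_arc {k : ℤ} {N : Net V β} (h : N.Valid k ∅) (hl : N.Loose k)
    {τ : V → ℤ} (hτ : ∀ v ∈ N.U, N.IsTight k τ v) {x : V} (hxU : x ∈ N.U) (hx : τ x < 0)
    (ho : 0 < N.o x)
    (ih : ∀ N' : Net V β, N'.Valid k ∅ → N'.U = N.U → N'.E = N.E →
      ∑ v ∈ N'.U, (N'.o v + N'.i v) < ∑ v ∈ N.U, (N.o v + N.i v) → N'.Solvable k) :
    N.Solvable k := by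
  refine Solvable.of_deleteArc ((hτ x hxU).lt_of_neg hx)
    (ih _ (h.deleteArc hl hxU ho ((hτ x hxU).slack_add hx)) rfl rfl ?_)
  rw [sum_add_distrib, sum_add_distrib, show (N.deleteArc x).U = N.U from rfl, sum_o_deleteArc,
    ind_of_mem hxU, show (N.deleteArc x).i = N.i from rfl]
  linarith

/-- Outer arcs whose direction agrees with the sign of the demand are deleted first. Then either all
demands have one sign, or an edge crosses from positive to negative demand; reversal halves the
cases. -/
lemma Valid.solvable_of_tight_vertices {k : ℤ} {N : Net V β} (h : N.Valid k ∅) (hk : 2 ≤ k)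
    (hl : N.Loose k) (hcard : 1 < N.U.card) {τ : V → ℤ} (hτ : ∀ v ∈ N.U, N.IsTight k τ v)
    (hne : ∀ v ∈ N.U, τ v ≠ 0)
    (ih : ∀ N' : Net V β, N'.Valid k ∅ → N'.U = N.U → N'.E.card < N.E.card → N'.Solvable k)
    (ih' : ∀ N' : Net V β, N'.Valid k ∅ → N'.U = N.U → N'.E = N.E →
      ∑ v ∈ N'.U, (N'.o v + N'.i v) < ∑ v ∈ N.U, (N.o v + N.i v) → N'.Solvable k) :
    N.Solvable k := by
  have hlr : N.rev.Loose k := fun A h3 h4 h5 => (hl A h3 h4 h5).rev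
  by_cases ho : ∃ x ∈ N.U, τ x < 0 ∧ 0 < N.o x
  · obtain ⟨x, hxU, hx, hox⟩ := ho
    exact h.solvable_of_nonpos_arc hl hτ hxU hx hox ih'
  by_cases hi : ∃ x ∈ N.U, 0 < τ x ∧ 0 < N.i x
  · obtain ⟨x, hxU, hx, hix⟩ := hi
    refine Solvable.of_rev (h.rev.solvable_of_nonpos_arc hlr (fun v hv => (hτ v hv).rev) hxU
      (neg_lt_zero.2 hx) hix fun N' h1 h2 h3 h4 => ih' N' h1 h2 h3 (h4.trans_eq ?_))
    exact sum_congr rfl fun v _ => add_comm _ _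
  push Not at ho hi
  set C := {v ∈ N.U | 0 < τ v} with hC
  by_cases hC0 : C = ∅
  · have hneg : ∀ v ∈ N.U, 0 < -τ v := fun v hv => by
      have h1 : v ∉ C := by simp [hC0]
      rw [hC, mem_filter, not_and] at h1
      have := h1 hv
      have := hne v hv
      omega
    exact Solvable.of_rev (h.rev.solvable_of_pos hk hlr hcard (fun v hv => (hτ v hv).rev) hneg
      (fun v hv => le_antisymm (ho v hv (by have := hneg v hv; omega)) (h.o_nonneg v)) ih)
  by_cases hCU : C = N.U
  · have hpos : ∀ v ∈ N.U, 0 < τ v := fun v hv => (mem_filter.1 (hCU ▸ hv : v ∈ C)).2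
    exact h.solvable_of_pos hk hl hcard hτ hpos
      (fun v hv => le_antisymm (hi v hv (hpos v hv)) (h.i_nonneg v)) ih
  have hCs : C ⊆ N.U := filter_subset _ _
  obtain ⟨e, he, hinc⟩ := h.exists_inc_ne_zero hk hCs (nonempty_iff_ne_empty.2 hC0) hCU hC0
    (sdiff_nonempty.2 fun h' => hCU (subset_antisymm hCs h')).ne_empty
  have hends := h.ends e he
  have hneg : ∀ v ∈ N.U, v ∉ C → τ v < 0 := fun v hv h1 => by
    rw [hC, mem_filter, not_and] at h1
    have := h1 hv
    have := hne v hv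
    omega
  unfold inc at hinc
  rcases ind_cases C (N.s e) with h1 | h1 <;> rcases ind_cases C (N.t e) with h2 | h2
  · omega
  · exact h.solvable_of_edge hl hτ he hends.2 hends.1 (N.joins_ends e) (mem_filter.1 h1.1).2
      (hneg _ hends.2 h2.1) ih
  · exact h.solvable_of_edge hl hτ he hends.1 hends.2 (N.joins_ends e).symm (mem_filter.1 h2.1).2
      (hneg _ hends.1 h1.1) ih
  · omega

/-! ### The orientation theorem -/

lemma solvable_of_card_le_one {k : ℤ} {N : Net V β} {S : Finset V} (h : N.Valid k S)
    (hcard : N.U.card ≤ 1) : N.Solvable k := by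
  refine ⟨fun _ => 1, fun _ => Or.inl rfl, fun v hv => ?_⟩
  have hU : N.U = {v} := eq_singleton_iff_unique_mem.2 ⟨hv, fun w hw => card_le_one.1 hcard _ hw _ hv⟩
  rw [← hU, excess_univ h]
  refine ⟨?_, h.net_lt⟩
  have := h.balanced
  rw [show ∑ v ∈ N.U, N.b v = N.b v by rw [hU, sum_singleton]] at this
  rw [← dvd_neg, neg_sub]
  exact this

/-- A vertex of degree zero can be deleted. -/
lemma Valid.solvable_of_deg_eq_zero {k : ℤ} {N : Net V β} {S : Finset V} {x : V}
    (h : N.Valid k S) (hxU : x ∈ N.U) (hb : 2 * k ∣ N.b x) (hdeg : N.deg {x} = 0)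
    (ih : ∀ (N' : Net V β) (S' : Finset V), N'.Valid k S' → N'.U = N.U.erase x → N'.Solvable k) :
    N.Solvable k := by
  have hA : N.U.erase x ⊆ N.U := erase_subset _ _
  have hsum : 0 ≤ ∑ e ∈ N.E, |N.inc e {x}| := sum_nonneg fun _ _ => abs_nonneg _
  have hox := h.o_nonneg x
  have hix := h.i_nonneg x
  have hdeg' := hdeg
  rw [deg, sum_singleton] at hdeg'
  have hinc : ∀ e ∈ N.E, N.inc e {x} = 0 := fun e he => by
    have h1 := (sum_eq_zero_iff_of_nonneg fun e _ => abs_nonneg (N.inc e {x})).1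
      (by omega : ∑ e ∈ N.E, |N.inc e {x}| = 0) e he
    exact abs_eq_zero.1 h1
  have hexx : ∀ σ, N.excess σ {x} = 0 := fun σ => by
    rw [excess, sum_singleton, sum_eq_zero fun e he => by rw [hinc e he, mul_zero]]
    omega
  have hex : ∀ σ, N.excess σ (N.U.erase x) = ∑ v ∈ N.U, (N.i v - N.o v) := fun σ => by
    rw [← excess_univ h σ, ← sum_excess_singleton, ← sum_excess_singleton N σ N.U,
      ← add_sum_erase _ _ hxU, hexx, zero_add]
  have hbe : ∑ v ∈ N.U, N.b v = N.b x + ∑ v ∈ N.U.erase x, N.b v := (add_sum_erase _ _ hxU).symm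
  -- No edge leaves `x`, so the rest carries all outer arcs and inherits their tightness.
  have hdege : N.deg (N.U.erase x) = ∑ v ∈ N.U, (N.o v + N.i v) := by
    have h1 := h.deg_add_deg_sdiff (singleton_subset_iff.2 hxU)
    rw [hdeg, sum_eq_zero fun e he => by rw [hinc e he, abs_zero], ← erase_eq] at h1
    linarith
  obtain ⟨σ, hσ, hσ'⟩ := ih _ _ (h.restrict (σ := fun _ => 1) hA (fun _ => Or.inl rfl)
    (by
      rw [hex, ← dvd_neg, neg_sub]
      have := dvd_sub h.balanced hb
      rwa [hbe, show N.b x + ∑ v ∈ N.U.erase x, N.b v - ∑ v ∈ N.U, (N.i v - N.o v) - N.b x =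
        ∑ v ∈ N.U.erase x, N.b v - ∑ v ∈ N.U, (N.i v - N.o v) by ring] at this)
    (by rw [hex]; exact h.net_lt)
    (fun m => by
      rw [hdege]
      refine h.upper_of_dvd ?_
      rw [hbe, show ∑ v ∈ N.U.erase x, N.b v + 2 * k * m - (N.b x + ∑ v ∈ N.U.erase x, N.b v) =
        2 * k * m - N.b x by ring]
      exact dvd_sub (dvd_mul_right _ _) hb)) rfl
  refine ⟨fun e => if N.s e ∈ N.U.erase x ∧ N.t e ∈ N.U.erase x then σ e else 1, fun e => ?_,
    fun v hv => ?_⟩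
  · dsimp only
    split_ifs
    exacts [hσ e, Or.inl rfl]
  · by_cases hvx : v = x
    · subst hvx
      rw [hexx, zero_sub, abs_zero]
      refine ⟨hb.neg_right, ?_⟩
      exact (abs_nonneg _).trans_lt h.net_lt
    · have := hσ' v (mem_erase.2 ⟨hvx, hv⟩)
      rwa [excess_restrict] at this

/-- The order of induction. -/
def measure (N : Net V β) (S : Finset V) : ℕ ×ₗ ℕ ×ₗ ℕ ×ₗ ℕ :=
  toLex (N.U.card, toLex (N.E.card, toLex ((∑ v ∈ N.U, (N.o v + N.i v)).toNat, 1 - S.card)))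

/-- The cases are, in order: a tight set with several vertices, an exempt vertex, a loose vertex, a
tight vertex of zero demand, and finally only nonzero demands. -/
lemma Valid.solvable_of_forall_measure_lt {k : ℤ} {N : Net V β} {S : Finset V} (h : N.Valid k S)
    (hk : 2 ≤ k) (ih : ∀ (N' : Net V β) (S' : Finset V), N'.measure S' < N.measure S →
      N'.Valid k S' → N'.Solvable k) : N.Solvable k := by
  have ihU : ∀ (N' : Net V β) (S' : Finset V), N'.Valid k S' → N'.U.card < N.U.card →
      N'.Solvable k := fun N' S' h1 h2 => ih N' S' (Prod.Lex.toLex_lt_toLex.2 (Or.inl h2)) h1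
  have ihE : ∀ N' : Net V β, N'.Valid k S → N'.U = N.U → N'.E.card < N.E.card →
      N'.Solvable k := fun N' h1 h2 h3 => ih N' S (Prod.Lex.toLex_lt_toLex.2
        (Or.inr ⟨congrArg card h2, Prod.Lex.toLex_lt_toLex.2 (Or.inl h3)⟩)) h1
  by_cases hcard : N.U.card ≤ 1
  · exact solvable_of_card_le_one h hcard
  rw [not_le] at hcard
  by_cases hl : N.Loose k
  swap
  · unfold Loose at hl
    push Not at hl
    obtain ⟨A, hA, hA1, hAU, hns⟩ := hl
    obtain ⟨a, ha⟩ := card_pos.1 (by omega : 0 < A.card)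
    refine h.solvable_of_tight hA ha (h.tight_of_not_slack hA hns)
      (ihU _ _ (h.contract hA ha hA1) ?_) (fun σ hσ => ihU _ _ hσ ?_)
    · have h1 := card_insert_le a (N.U \ A)
      rw [card_sdiff_of_subset hA] at h1
      have h2 := card_le_card hA
      change (insert a (N.U \ A)).card < _
      omega
    · exact card_lt_card (ssubset_of_subset_of_ne hA hAU)
  by_cases hS : S = ∅
  swap
  · obtain ⟨x, rfl⟩ := card_eq_one.1
      (le_antisymm h.card_le (card_pos.2 (nonempty_iff_ne_empty.2 hS)))
    obtain ⟨hxU, hb⟩ := h.exempt x (mem_singleton_self x)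
    rcases (deg_nonneg h {x}).eq_or_lt with h0 | h0
    · refine h.solvable_of_deg_eq_zero hxU hb h0.symm fun N' S' h1 h2 => ihU N' S' h1 ?_
      rw [h2]
      exact card_erase_lt_of_mem hxU
    · exact h.exists_reduction hk hl hxU hcard (Or.inl rfl) h0 ihE
  subst hS
  by_cases hs : ∃ x ∈ N.U, N.Slack k (2 * k) {x}
  · obtain ⟨x, hxU, hx⟩ := hs
    refine h.exists_reduction hk hl hxU hcard (Or.inr hx) ?_ ihE
    obtain ⟨m, hm⟩ := hx
    have := abs_nonneg (∑ v ∈ {x}, N.b v + 2 * k * m)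
    omega
  push Not at hs
  have hex : ∀ v : V, ∃ t : ℤ, v ∈ N.U →
      2 * k ∣ t - N.b v ∧ N.deg {v} = 2 * k - 2 + |t| ∧ |t| ≤ k := fun v => by
    by_cases hv : v ∈ N.U
    · obtain ⟨t, ht⟩ := h.exists_isTight hcard hv (hs v hv)
      exact ⟨t, fun _ => ht⟩
    · exact ⟨0, fun h' => absurd h' hv⟩
  choose τ hτ using hex
  have hτ' : ∀ v ∈ N.U, N.IsTight k τ v := fun v hv => ⟨(hτ v hv).1, (hτ v hv).2.1, (hτ v hv).2.2⟩
  by_cases h0 : ∃ x ∈ N.U, τ x = 0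
  · obtain ⟨x, hxU, hx⟩ := h0
    -- The net stays the same. Declaring `x` exempt lowers the last component of the measure and
    -- makes the lifting at `x` available.
    refine ih N {x} ?_ { h with
      lower := fun A h1 h2 h3 _ => h.lower A h1 h2 h3 h2.ne_empty
      exempt := fun y hy => ?_
      card_le := by simp }
    · refine Prod.Lex.toLex_lt_toLex.2 (Or.inr ⟨rfl, Prod.Lex.toLex_lt_toLex.2 (Or.inr ⟨rfl,
        Prod.Lex.toLex_lt_toLex.2 (Or.inr ⟨rfl, ?_⟩)⟩)⟩)
      simp
    · rw [mem_singleton.1 hy]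
      have h1 := (hτ' x hxU).dvd
      rw [hx, zero_sub, dvd_neg] at h1
      exact ⟨hxU, h1⟩
  push Not at h0
  refine h.solvable_of_tight_vertices hk hl hcard hτ' h0 ihE fun N' h1 h2 h3 h4 => ?_
  refine ih N' ∅ (Prod.Lex.toLex_lt_toLex.2 (Or.inr ⟨congrArg card h2, Prod.Lex.toLex_lt_toLex.2
    (Or.inr ⟨congrArg card h3, Prod.Lex.toLex_lt_toLex.2 (Or.inl ?_)⟩)⟩)) h1
  have h5 : 0 ≤ ∑ v ∈ N'.U, (N'.o v + N'.i v) :=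
    sum_nonneg fun v _ => add_nonneg (h1.o_nonneg v) (h1.i_nonneg v)
  simp only
  omega

theorem Valid.solvable {k : ℤ} (hk : 2 ≤ k) (N : Net V β) (S : Finset V) (h : N.Valid k S) :
    N.Solvable k := by
  induction hm : N.measure S using WellFoundedLT.induction generalizing N S with
  | ind m ih =>
    subst hm
    exact h.solvable_of_forall_measure_lt hk fun N' S' h1 h2 => ih _ h1 N' S' h2 rfl

end Net

namespace Graph

open Finset Net

variable {α β : Type*} {G : Graph α β}

lemma IsLink.mem_edgeCut_iff {e : β} {x y : α} (h : G.IsLink e x y) {A : Set α} :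
    e ∈ G.edgeCut A ↔ ¬(x ∈ A ↔ y ∈ A) := by
  constructor
  · rintro ⟨u, v, huv, hu, hv⟩
    obtain ⟨rfl, rfl⟩ | ⟨rfl, rfl⟩ := h.eq_and_eq_or_eq_and_eq huv <;> tauto
  · intro h'
    by_cases hx : x ∈ A
    · exact ⟨x, y, h, hx, by tauto⟩
    · exact ⟨y, x, h.symm, by tauto, hx⟩

lemma edgeCut_subset_edgeSet (G : Graph α β) (A : Set α) : G.edgeCut A ⊆ G.edgeSet :=
  fun _ ⟨_, _, h, _⟩ => h.edge_mem

lemma edgeCut_symmDiff (G : Graph α β) (A B : Set α) :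
    G.edgeCut (symmDiff A B) = symmDiff (G.edgeCut A) (G.edgeCut B) := by
  ext e
  by_cases he : e ∈ G.edgeSet
  · obtain ⟨x, y, h⟩ := G.exists_isLink_of_mem_edgeSet he
    simp only [Set.mem_symmDiff, h.mem_edgeCut_iff]
    tauto
  · have h1 : ∀ A, e ∉ G.edgeCut A := fun A h => he (G.edgeCut_subset_edgeSet A h)
    simp [Set.mem_symmDiff, h1]

lemma edgeCut_restrict (G : Graph α β) (F : Set β) (A : Set α) :
    (G.restrict F).edgeCut A = G.edgeCut A ∩ F := by
  ext e
  simp only [edgeCut, restrict_isLink, Set.mem_inter_iff, Set.mem_ofPred_eq]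
  tauto

/-- Every graph has a bipartite factor that contains at least half of the edges of every cut. -/
lemma exists_bipartite_restrict (hV : G.vertexSet.Finite) (hE : G.edgeSet.Finite) :
    ∃ F : Set β, (G.restrict F).IsBipartiteGraph ∧
      ∀ A ⊆ G.vertexSet, (G.edgeCut A).ncard ≤ 2 * ((G.restrict F).edgeCut A).ncard := by
  obtain ⟨X, hX, hmax⟩ := Set.exists_max_image {X | X ⊆ G.vertexSet}
    (fun X => (G.edgeCut X).ncard) hV.finite_subsets ⟨∅, Set.empty_subset _⟩
  refine ⟨G.edgeCut X, ⟨X, hX, fun e x y h => ?_⟩, fun A hA => ?_⟩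
  · rw [restrict_isLink] at h
    have h2 := h.2.mem_edgeCut_iff.1 h.1
    tauto
  · have hfin : ∀ A, (G.edgeCut A).Finite := fun A => hE.subset (G.edgeCut_subset_edgeSet A)
    -- Switching `A` exchanges the edges of its cut inside and outside the maximum cut, so at least
    -- half of them lie inside.
    have h1 := hmax (symmDiff X A) (Set.union_subset (Set.sdiff_subset.trans hX)
      (Set.sdiff_subset.trans hA))
    rw [edgeCut_symmDiff, Set.symmDiff_def, Set.ncard_union_eq
      (Set.disjoint_of_subset_right Set.sdiff_subset Set.disjoint_sdiff_left)
      ((hfin X).subset Set.sdiff_subset) ((hfin A).subset Set.sdiff_subset)] at h1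
    have h2 := Set.ncard_inter_add_ncard_sdiff_eq_ncard (G.edgeCut X) (G.edgeCut A) (hfin X)
    have h3 := Set.ncard_inter_add_ncard_sdiff_eq_ncard (G.edgeCut A) (G.edgeCut X) (hfin A)
    rw [Set.inter_comm] at h2
    rw [edgeCut_restrict]
    omega

lemma IsBipartiteGraph.restrict (h : G.IsBipartiteGraph) (F : Set β) :
    (G.restrict F).IsBipartiteGraph := by
  obtain ⟨X, hX, h⟩ := h
  exact ⟨X, hX, fun e x y h' => h e x y (by rw [restrict_isLink] at h'; exact h'.2)⟩

lemma IsBipartiteGraph.vertexDegree_eq (h : G.IsBipartiteGraph) (v : α) :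
    G.vertexDegree v = (G.incidenceSet v).ncard := by
  obtain ⟨X, -, h⟩ := h
  have : G.loopSet v = ∅ := by
    ext e
    simp only [mem_loopSet, Set.mem_empty_iff_false, iff_false]
    intro h'
    have := h e v v h'
    tauto
  rw [vertexDegree, this, Set.ncard_empty, add_zero]

lemma IsBipartiteGraph.edgeCut_singleton (h : G.IsBipartiteGraph) (v : α) :
    G.edgeCut {v} = G.incidenceSet v := by
  obtain ⟨X, -, h⟩ := h
  ext e
  simp only [edgeCut, Set.mem_ofPred_eq, Set.mem_singleton_iff, mem_incidenceSet]
  constructor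
  · rintro ⟨x, y, h1, rfl, -⟩
    exact h1.inc_left
  · rintro ⟨y, h1⟩
    refine ⟨v, y, h1, rfl, ?_⟩
    rintro rfl
    have := h e _ _ h1
    tauto

lemma restrict_isSpanningSubgraph (G : Graph α β) (F : Set β) :
    (G.restrict F).IsSpanningSubgraph G :=
  ⟨restrict_le, rfl⟩

lemma IsEdgeConnected.le_ncard_incidenceSet {l : ℤ} (h : G.IsEdgeConnected l)
    (hb : G.IsBipartiteGraph) (hG : G.vertexSet.Nontrivial) {v : α} (hv : v ∈ G.vertexSet) :
    l ≤ (G.incidenceSet v).ncard := by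
  rw [← hb.edgeCut_singleton]
  refine h {v} (Set.singleton_subset_iff.2 hv) (Set.singleton_nonempty v) fun h' => ?_
  rw [← h'] at hG
  exact Set.not_nontrivial_singleton hG

lemma exists_abs_le (k r : ℤ) (hk : 0 < k) : ∃ m : ℤ, |-r + 2 * k * m| ≤ k := by
  have h1 := Int.emod_add_mul_ediv r (2 * k)
  have h2 := Int.emod_nonneg r (show 2 * k ≠ 0 by omega)
  have h3 := Int.emod_lt_of_pos r (show 0 < 2 * k by omega)
  by_cases h4 : r % (2 * k) ≤ k
  · refine ⟨r / (2 * k), ?_⟩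
    rw [abs_le]
    constructor <;> linarith
  · refine ⟨r / (2 * k) + 1, ?_⟩
    rw [abs_le]
    constructor <;> linarith

/-- The net has no outer arcs, all edges point out of `X`, and the prescription is minus the degree
on `X` and plus the degree off `X`. -/
theorem IsBipartiteGraph.hasBipartiteModuloRegularFactor {k : ℕ} (hk : 1 ≤ k)
    (hV : G.vertexSet.Finite) (hE : G.edgeSet.Finite) (hG : G.vertexSet.Nontrivial)
    (hb : G.IsBipartiteGraph) (hc : G.IsEdgeConnected (2 * (k : ℤ)))
    (hess : G.IsEssentiallyEdgeConnected (3 * (k : ℤ) - 3)) :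
    G.HasBipartiteModuloRegularFactor k := by
  classical
  obtain rfl | hk2 := hk.eq_or_lt
  -- For `k = 1` the graph itself serves; the orientation theorem needs `2 ≤ k`.
  · refine ⟨G, .rfl, hb, fun v hv => ⟨?_, one_dvd _⟩⟩
    have := hc.le_ncard_incidenceSet hb hG hv
    rw [hb.vertexDegree_eq]
    omega
  obtain ⟨X, hX, hlink⟩ := hb
  have hb : G.IsBipartiteGraph := ⟨X, hX, hlink⟩
  have hends : ∀ e : β, ∃ p : α × α, e ∈ G.edgeSet → G.IsLink e p.1 p.2 ∧ p.1 ∈ X ∧ p.2 ∉ X := by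
    intro e
    by_cases he : e ∈ G.edgeSet
    · obtain ⟨x, y, h⟩ := G.exists_isLink_of_mem_edgeSet he
      have h1 := hlink e x y h
      by_cases hx : x ∈ X
      · exact ⟨(x, y), fun _ => ⟨h, hx, h1.1 hx⟩⟩
      · exact ⟨(y, x), fun _ => ⟨h.symm, by tauto, hx⟩⟩
    · obtain ⟨v, -⟩ := hG.nonempty
      exact ⟨(v, v), fun h => absurd h he⟩
  choose p hp using hends
  let N : Net α β :=
    { U := hV.toFinset
      E := hE.toFinset
      s := fun e => (p e).1
      t := fun e => (p e).2
      o := fun _ => 0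
      i := fun _ => 0
      b := fun v => -∑ e ∈ hE.toFinset, (ind {v} (p e).1 - ind {v} (p e).2) }
  have hNb : ∀ A : Finset α, ∑ v ∈ A, N.b v = -∑ e ∈ N.E, N.inc e A := fun A => by
    rw [← sum_congr rfl fun e _ => sum_inc_singleton N e A, sum_comm, ← sum_neg_distrib]
    rfl
  have hdeg : ∀ A : Finset α, N.deg A = ∑ e ∈ N.E, |N.inc e A| := fun A => by
    simp [Net.deg, N]
  have hex : ∀ σ, ∀ A : Finset α, N.excess σ A = ∑ e ∈ N.E, σ e * N.inc e A := fun σ A => by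
    simp [Net.excess, N]
  have hE' : ∀ e, e ∈ N.E ↔ e ∈ G.edgeSet := fun e => by simp [N]
  have hmem : ∀ e ∈ N.E, ∀ A : Finset α, e ∈ G.edgeCut (A : Set α) ↔ N.inc e A ≠ 0 := by
    intro e he A
    rw [((hp e ((hE' e).1 he)).1).mem_edgeCut_iff]
    simp only [Net.inc, N, ind, mem_coe]
    split_ifs <;> simp_all
  have hcard : ∀ (P : β → Prop) (A : Finset α),
      (({e | e ∈ N.E ∧ P e ∧ N.inc e A ≠ 0} : Set β).ncard : ℤ) =
        ∑ e ∈ N.E, if P e then |N.inc e A| else 0 := by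
    intro P A
    rw [← coe_filter, Set.ncard_coe_finset, card_filter, Nat.cast_sum]
    refine sum_congr rfl fun e _ => ?_
    rcases abs_inc_cases N e A with h | h | h <;> by_cases hP : P e <;> simp [h, hP]
  have hcut : ∀ A : Finset α, ((G.edgeCut (A : Set α)).ncard : ℤ) = N.deg A := by
    intro A
    have h1 : G.edgeCut (A : Set α) = {e | e ∈ N.E ∧ True ∧ N.inc e A ≠ 0} := by
      ext e
      simp only [Set.mem_ofPred_eq, true_and]
      constructor
      · intro h
        have he := (hE' e).2 (G.edgeCut_subset_edgeSet _ h)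
        exact ⟨he, (hmem e he A).1 h⟩
      · rintro ⟨he, h⟩
        exact (hmem e he A).2 h
    rw [h1, hcard (fun _ => True) A, hdeg]
    simp
  have hpar : ∀ A : Finset α, (2 : ℤ) ∣ N.deg A - ∑ e ∈ N.E, N.inc e A := fun A => by
    rw [hdeg, ← sum_sub_distrib]
    exact dvd_sum fun e _ => two_dvd_abs_sub _
  have hends' : ∀ e ∈ N.E, N.s e ∈ N.U ∧ N.t e ∈ N.U := fun e he => by
    have h1 := (hp e ((hE' e).1 he)).1
    simp only [N, Set.Finite.mem_toFinset]
    exact ⟨h1.left_mem, h1.right_mem⟩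
  have hvalid : N.Valid k ∅ :=
    { ends := hends'
      o_nonneg := fun _ => le_rfl
      i_nonneg := fun _ => le_rfl
      parity := fun v _ => by
        have h1 := hpar {v}
        have h2 := hNb {v}
        rw [sum_singleton] at h2
        omega
      balanced := by
        rw [hNb, sum_eq_zero fun e he => by
          rw [Net.inc, ind_of_mem (hends' e he).1, ind_of_mem (hends' e he).2, sub_self]]
        simp [N]
      net_lt := by simp [N]; omega
      upper := fun m => by
        have := abs_nonneg (2 * (k : ℤ) * m)
        simp only [N, sub_zero, add_zero, sum_const_zero, zero_add]
        omega
      lower := fun A hA hne hAU _ => by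
        have hA' : (A : Set α) ⊆ G.vertexSet := fun v hv => by simpa [N] using hA hv
        have hAU' : (A : Set α) ≠ G.vertexSet := fun h' => hAU (by
          ext v
          rw [← mem_coe, h']
          simp [N])
        have h1 := hc A hA' (coe_nonempty.2 hne) hAU'
        rw [hcut] at h1
        unfold Net.Slack
        rw [hNb]
        by_cases h2 : 3 * (k : ℤ) - 3 ≤ N.deg A
        -- An admissible excess of size `k` would need degree `3 * k - 2`; parity supplies the
        -- missing unit.
        · obtain ⟨m, hm⟩ := exists_abs_le k (∑ e ∈ N.E, N.inc e A) (by omega)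
          refine ⟨m, ?_⟩
          have h3 := hpar A
          have h4 := two_dvd_abs_sub (-∑ e ∈ N.E, N.inc e A + 2 * k * m)
          have h5 : (2 : ℤ) ∣ 2 * k * m := ⟨k * m, by ring⟩
          omega
        · obtain ⟨v, -, hv⟩ := hess A hA' (coe_nonempty.2 hne) hAU' (by rw [hcut]; omega)
          -- All cut edges share `v`, so they all leave `A` or all enter it, according to the sides
          -- of `v`.
          have hsame : ∃ δ : ℤ, (δ = 1 ∨ δ = -1) ∧
              ∀ e ∈ N.E, N.inc e A = δ * |N.inc e A| := by
            refine ⟨if (v ∈ X ↔ v ∈ A) then 1 else -1, by split_ifs <;> simp, fun e he => ?_⟩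
            by_cases h0 : N.inc e A = 0
            · simp [h0]
            · have h3 := hv e ((hmem e he A).2 h0)
              obtain ⟨h4, h5, h6⟩ := hp e ((hE' e).1 he)
              have h7 : N.inc e A = ind A (p e).1 - ind A (p e).2 := rfl
              rcases h3.eq_or_eq_of_isLink h4 with h8 | h8 <;>
                rcases ind_cases A (p e).1 with h9 | h9 <;>
                rcases ind_cases A (p e).2 with h10 | h10 <;>
                simp_all
          obtain ⟨δ, hδ, hs⟩ := hsame
          have h3 : ∑ e ∈ N.E, N.inc e A = δ * N.deg A := by
            rw [hdeg, mul_sum]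
            exact sum_congr rfl hs
          -- Shifting by `2 * k * δ` gives an excess of size `deg A - 2 * k`, nonnegative by
          -- edge-connectivity, which leaves slack `2 * k`.
          refine ⟨δ, ?_⟩
          rw [h3, show -(δ * N.deg A) + 2 * (k : ℤ) * δ = δ * (2 * k - N.deg A) by ring, abs_mul,
            abs_of_nonpos (by omega : 2 * (k : ℤ) - N.deg A ≤ 0)]
          rcases hδ with rfl | rfl <;> simp
      exempt := by simp
      card_le := by simp }
  obtain ⟨σ, hσ, hsol⟩ := hvalid.solvable (by exact_mod_cast hk2)
  refine ⟨G.restrict {e | σ e = 1}, G.restrict_isSpanningSubgraph _, hb.restrict _, fun v hv => ?_⟩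
  have hinc : ((G.restrict {e | σ e = 1}).incidenceSet v) =
      {e | e ∈ N.E ∧ σ e = 1 ∧ N.inc e {v} ≠ 0} := by
    rw [← (hb.restrict _).edgeCut_singleton, edgeCut_restrict]
    ext e
    simp only [Set.mem_inter_iff, Set.mem_ofPred_eq]
    have h1 := fun he => hmem e he {v}
    rw [coe_singleton] at h1
    constructor
    · rintro ⟨h, h'⟩
      have he := (hE' e).2 (G.edgeCut_subset_edgeSet _ h)
      exact ⟨he, h', (h1 he).1 h⟩
    · rintro ⟨he, h', h⟩
      exact ⟨(h1 he).2 h, h'⟩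
  have hsame : ∃ δ : ℤ, (δ = 1 ∨ δ = -1) ∧ ∀ e ∈ N.E, N.inc e {v} = δ * |N.inc e {v}| := by
    refine ⟨if v ∈ X then 1 else -1, by split_ifs <;> simp, fun e he => ?_⟩
    obtain ⟨h4, h5, h6⟩ := hp e ((hE' e).1 he)
    have h7 : N.inc e {v} = ind {v} (p e).1 - ind {v} (p e).2 := rfl
    rw [h7]
    unfold ind
    by_cases h8 : (p e).1 = v <;> by_cases h9 : (p e).2 = v <;> simp_all
  obtain ⟨δ, hδ, hs⟩ := hsame
  obtain ⟨h1, h2⟩ := hsol v (by simpa [N] using hv)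
  have hv2 : 2 * (k : ℤ) ≤ N.deg {v} := by
    have := hc.le_ncard_incidenceSet hb hG hv
    rwa [← hb.edgeCut_singleton, ← coe_singleton, hcut] at this
  have hbv : N.b v = -(δ * N.deg {v}) := by
    rw [← sum_singleton N.b v, hNb, hdeg, mul_sum, sum_congr rfl hs]
  -- At `v` all edges have incidence of sign `δ`, so chosen edges count twice and the others cancel.
  have hfv : 2 * (((G.restrict {e | σ e = 1}).vertexDegree v : ℕ) : ℤ) =
      N.deg {v} + δ * N.excess σ {v} := by
    rw [(hb.restrict _).vertexDegree_eq, hinc, hcard (fun e => σ e = 1) {v}, hdeg, hex, mul_sum,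
      mul_sum, ← sum_add_distrib]
    refine sum_congr rfl fun e he => ?_
    have h3 := hs e he
    generalize |N.inc e {v}| = a at *
    rw [h3]
    rcases hσ e with h4 | h4 <;> rcases hδ with rfl | rfl <;> rw [h4] <;> norm_num <;> ring
  rw [hbv] at h1
  generalize (G.restrict {e | σ e = 1}).vertexDegree v = d at *
  generalize N.excess σ {v} = f at *
  rw [abs_lt] at h2
  have h3 : 2 * (k : ℤ) ∣ 2 * d := by
    rw [hfv]
    rcases hδ with rfl | rfl
    · simpa [add_comm] using h1
    · rw [show N.deg {v} + -1 * f = -(f - -(-1 * N.deg {v})) by ring]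
      exact h1.neg_right
  refine ⟨?_, ?_⟩
  · rcases hδ with rfl | rfl <;> omega
  · exact_mod_cast (mul_dvd_mul_iff_left (two_ne_zero' ℤ)).1 h3

lemma HasBipartiteModuloRegularFactor.of_restrict {k : ℕ} {F : Set β}
    (h : (G.restrict F).HasBipartiteModuloRegularFactor k) :
    G.HasBipartiteModuloRegularFactor k := by
  obtain ⟨H, h1, h2, h3⟩ := h
  exact ⟨H, h1.trans (G.restrict_isSpanningSubgraph F), h2, h3⟩

end Graph

theorem mainTheorem5 {α β : Type*} (k : ℕ) (hk : 1 ≤ k) (G : Graph α β)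
    (hV : G.vertexSet.Finite) (hE : G.edgeSet.Finite) (hG : G.vertexSet.Nontrivial) :
    (G.IsEdgeConnected (4 * (k : ℤ) - 1) →
      G.IsEssentiallyEdgeConnected (6 * (k : ℤ) - 7) →
      G.HasBipartiteModuloRegularFactor k) ∧
    (G.IsBipartiteGraph →
      G.IsEdgeConnected (2 * (k : ℤ)) →
      G.IsEssentiallyEdgeConnected (3 * (k : ℤ) - 3) →
      G.HasBipartiteModuloRegularFactor k) := by
  refine ⟨fun hc hess => ?_, fun hb hc hess =>
    hb.hasBipartiteModuloRegularFactor hk hV hE hG hc hess⟩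
  obtain ⟨F, hb, hF⟩ := Graph.exists_bipartite_restrict hV hE
  refine Graph.HasBipartiteModuloRegularFactor.of_restrict (F := F)
    (Graph.IsBipartiteGraph.hasBipartiteModuloRegularFactor (G := G.restrict F) hk hV
      (hE.subset (Graph.IsSubgraph.edgeSet_mono Graph.restrict_le)) hG hb ?_ ?_)
  -- Half of `4 * k - 1` rounds up to `2 * k`.
  · intro A hA hne hAU
    have h1 := hc A hA hne hAU
    have h2 := hF A hA
    omega
  -- At most `3 * k - 4` edges in the factor mean at most `6 * k - 8` in `G`.
  · intro A hA hne hAU hlt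
    have h2 := hF A hA
    obtain ⟨v, hv, h⟩ := hess A hA hne hAU (by omega)
    refine ⟨v, hv, fun e he => ?_⟩
    rw [Graph.edgeCut_restrict] at he
    exact Graph.restrict_inc.2 ⟨h e he.1, he.2⟩
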